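/- **Setting.** For $\mathbf x\in\mathbb R^n$ let $\mathbf s=\{i: x_i\neq 0\}$ be its sparsity pattern and $k=|\mathbf s|$ its sparsity. One observes $\mathbf Y=\mathbf A\mathbf x+\mathbf W\in\mathbb R^m$, where $\mathbf A$ is a (possibly random) $m\times n$ matrix with $\mathbb E[\operatorname{tr}(\mathbf A\mathbf A^T)]=m$ and $\mathbf W$, independent of $\mathbf A$, has i.i.d. standard Gaussian entries. An estimator $\hat{\mathbf s}(\mathbf Y,\mathbf A,k)$ is a measurable function whose value is a set of size $k$, and $d(\mathbf s,\hat{\mathbf s})=1-|\mathbf s\cap\hat{\mathbf s}|/|\mathbf s|$. Let $0<\Omega\le 1/2$ and let $F$ be the distribution of a real random variable $X$ with $\mathbb E X^2<\infty$ and $\Pr\{X=0\}=0$. The source $\mathcal X(\Omega,F)$ is the set of all sequences $(\mathbf x^n)_n$, $\mathbf x^n\in\mathbb R^n$, such that $\mathbf x^n$ has exactly $\lfloor\Omega n\rfloor$ nonzero entries and the empirical distribution function of the nonzero entries of $\mathbf x^n$ converges to $F$ uniformly as $n\to\infty$. A pair $(\rho,\alpha)$ is achievable for $\mathcal X(\Omega,F)$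 if for each $n$ there are a $\lceil\rho n\rceil\times n$ sampling matrix $\mathbf A$ as above and an estimator such that for every sequence $(\mathbf x^n)\in\mathcal X(\Omega,F)$, with $\mathbf s^n$ the sparsity pattern of $\mathbf x^n$, $\Pr\{d(\mathbf s^n,\hat{\mathbf s}(\mathbf Y,\mathbf A,\lfloor\Omega n\rfloor))>\alpha\}\to 0$ as $n\to\infty$. The sampling rate distortion function $\rho(\alpha)\in[0,\infty]$ is the infimum of the $\rho\ge 0$ for which $(\rho,\alpha)$ is achievable ($\infty$ if there is none). Let $H(p)=-p\log p-(1-p)\log(1-p)$, $$R(\Omega,\alpha)=\begin{cases}H(\Omega)-\Omega H(\alpha)-(1-\Omega)H\big(\tfrac{\Omega\alpha}{1-\Omega}\big)&\alpha<1-\Omega\\0&\alpha\ge 1-\Omega\end{cases},\qquad V(\Omega,G)=\Omega(1-\Omega)\mu_G^2+\Omega\sigma_G^2,$$ where $\mu_G,\sigma_G^2$ are the mean and variance of $G$. For $0<\beta\le1$ let $F_\beta$ be the conditional distribution of $X$ given $Z=0$, where $Z\in\{0,1\}$ and, given $X$, $\Pr\{Z=1\}$ is $1$ if $|X|>t_\beta$,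 $p_\beta$ if $|X|=t_\beta$ and $0$ if $|X|<t_\beta$, with $t_\beta\in[0,\infty]$ and $p_\beta\in[0,1]$ chosen such that $\Pr\{Z=0\}=\beta$. **Theorem 3.** For every $0\le\alpha\le 1$, the sampling rate distortion function of $\mathcal X(\Omega,F)$ satisfies $$\rho(\alpha)\ \ge\ \sup_{\substack{\alpha\le\beta\le1\\ \beta>0}}\ \frac{2\,(1-(1-\beta)\Omega)\;R\!\left(\frac{\beta\Omega}{1-(1-\beta)\Omega},\frac{\alpha}{\beta}\right)}{\log\big(1+V(\beta\Omega,F_\beta)\big)} .$$ -/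

import Mathlib

open MeasureTheory ProbabilityTheory Filter Topology
open scoped ENNReal NNReal Matrix

noncomputable section

namespace SparsityRecovery

/-- The sparsity pattern of a vector: the set of indices of its nonzero entries. -/
def sparsityPattern {n : ℕ} (x : Fin n → ℝ) : Finset (Fin n) :=
  Finset.univ.filter fun i => x i ≠ 0

/-- The distortion `d(s, s') = 1 - |s ∩ s'| / |s|` between a (nonempty) sparsity pattern and an
estimate of the same size. -/
def distortion {n : ℕ} (s s' : Finset (Fin n)) : ℝ :=
  1 - ((s ∩ s').card : ℝ) / (s.card : ℝ)

/-- The entrywise (product, hence Borel) `σ`-algebra on real matrices. -/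
instance instMeasurableSpaceMatrix {m n : ℕ} : MeasurableSpace (Matrix (Fin m) (Fin n) ℝ) :=
  inferInstanceAs (MeasurableSpace (Fin m → Fin n → ℝ))

/-- A random `m × n` sampling matrix, given by its law, with the normalization
`E[tr(A Aᵀ)] = m`. Nothing else is assumed; a deterministic matrix is the case of a Dirac law. -/
structure SamplingMatrix (m n : ℕ) where
  /-- The law of the random matrix. -/
  law : Measure (Matrix (Fin m) (Fin n) ℝ)
  isProbabilityMeasure : IsProbabilityMeasure law
  normalized : ∫⁻ A, ENNReal.ofReal (Matrix.trace (A * Aᵀ)) ∂law = (m : ℝ≥0∞)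

/-- A sparsity pattern estimator `ŝ(y, A, k)`: a measurable function of the samples, the sampling
matrix and the sparsity, whose value is a set of size `k`. -/
structure Estimator (m n : ℕ) where
  /-- The estimate `ŝ(y, A, k)`. -/
  toFun : (Fin m → ℝ) → Matrix (Fin m) (Fin n) ℝ → ℕ → Finset (Fin n)
  card_eq : ∀ y A k, k ≤ n → (toFun y A k).card = k
  measurableSet_eq : ∀ (k : ℕ) (s : Finset (Fin n)),
    MeasurableSet {p : (Fin m → ℝ) × Matrix (Fin m) (Fin n) ℝ | toFun p.1 p.2 k = s}

/-- The probability that the distortion exceeds `α` when the vector `x` is observed through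
`Y = A x + W`, where `W` has i.i.d. standard Gaussian entries and is independent of the random
matrix `A`, and the estimator is given `(Y, A, k)` with `k` the sparsity of `x`. -/
def errorProb {m n : ℕ} (P : SamplingMatrix m n) (est : Estimator m n) (α : ℝ)
    (x : Fin n → ℝ) : ℝ≥0∞ :=
  (P.law.prod (Measure.pi fun _ : Fin m => gaussianReal 0 1))
    {p | α < distortion (sparsityPattern x)
      (est.toFun (p.1 *ᵥ x + p.2) p.1 (sparsityPattern x).card)}

/-- A vector source: a collection of sequences of vectors, the `n`-th one of length `n`. -/
abbrev VectorSource : Type := Set ((n : ℕ) → Fin n → ℝ)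

/-- The pair `(ρ, α)` is achievable for a source if there are sampling matrices of size
`⌈ρ n⌉ × n` and estimators for which the error probability tends to zero along every sequence of
vectors of the source. (For a source of the form `{x | ∀ n, x n ∈ 𝒳 n}` with nonempty `𝒳 n` this
says that the supremum of the error probability over `𝒳 n` tends to zero.) -/
def Achievable (𝒳 : VectorSource) (ρ : ℝ≥0) (α : ℝ) : Prop :=
  ∃ (P : (n : ℕ) → SamplingMatrix ⌈ρ * (n : ℝ≥0)⌉₊ n)
    (est : (n : ℕ) → Estimator ⌈ρ * (n : ℝ≥0)⌉₊ n),
    ∀ x ∈ 𝒳, Tendsto (fun n => errorProb (P n) (est n) α (x n)) atTop (𝓝 0)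

/-- The sampling rate distortion function `ρ(α)` of a source: the infimum of the achievable
rates, equal to `∞` if there is none. -/
def rateDistortion (𝒳 : VectorSource) (α : ℝ) : ℝ≥0∞ :=
  ⨅ (ρ : ℝ≥0) (_ : Achievable 𝒳 ρ α), (ρ : ℝ≥0∞)

/-- The empirical distribution function of the nonzero entries of a vector. -/
def empiricalCDF {n : ℕ} (x : Fin n → ℝ) (t : ℝ) : ℝ :=
  (((sparsityPattern x).filter fun i => x i ≤ t).card : ℝ) / ((sparsityPattern x).card : ℝ)

/-- The source `𝒳(Ω, F)`: the sequences of vectors with exactly `⌊Ω n⌋` nonzero entries for which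
the empirical distribution function of the nonzero entries converges to that of `F` uniformly. -/
def source (Ω : ℝ) (F : Measure ℝ) : VectorSource :=
  {x | (∀ n : ℕ, (sparsityPattern (x n)).card = ⌊Ω * (n : ℝ)⌋₊) ∧
    TendstoUniformly (fun n t => empiricalCDF (x n) t) (fun t => cdf F t) atTop}

/-- The rate, in nats per dimension, needed to encode a sparsity pattern to within distortion
`α`; `Real.binEntropy` is the binary entropy with natural logarithms. -/
def encodingRate (Ω α : ℝ) : ℝ :=
  if α < 1 - Ω then
    Real.binEntropy Ω - Ω * Real.binEntropy α
      - (1 - Ω) * Real.binEntropy (Ω * α / (1 - Ω))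
  else 0

/-- The variance `V(Ω, F) = Ω (1 - Ω) μ_F ^ 2 + Ω σ_F ^ 2` of a source. -/
def sourceVariance (Ω : ℝ) (F : Measure ℝ) : ℝ :=
  Ω * (1 - Ω) * (∫ x, x ∂F) ^ 2 + Ω * variance id F

/-- The threshold `t_β`: the `β`-quantile of `|X|`. It may be infinite when `β = 1`. -/
def truncThreshold (F : Measure ℝ) (β : ℝ) : ℝ≥0∞ :=
  sInf {t | ENNReal.ofReal β ≤ F {x | ‖x‖ₑ ≤ t}}

/-- The probability `p_β` of `Z = 1` given `|X| = t_β`, determined by `Pr{Z = 0} = β`. -/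
def truncTieProb (F : Measure ℝ) (β : ℝ) : ℝ≥0∞ :=
  1 - (ENNReal.ofReal β - F {x | ‖x‖ₑ < truncThreshold F β})
    / F {x | ‖x‖ₑ = truncThreshold F β}

/-- The conditional probability of `Z = 0` given `X = x`. -/
def keepProb (F : Measure ℝ) (β : ℝ) (x : ℝ) : ℝ≥0∞ :=
  if ‖x‖ₑ < truncThreshold F β then 1
  else if ‖x‖ₑ = truncThreshold F β then 1 - truncTieProb F β
  else 0

/-- The measure `B ↦ Pr{X ∈ B, Z = 0}`. -/
def keptMeasure (F : Measure ℝ) (β : ℝ) : Measure ℝ :=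
  F.withDensity (keepProb F β)

/-- The `β`-truncated distribution `F_β`: the conditional law of `X` given `Z = 0`. -/
def truncated (F : Measure ℝ) (β : ℝ) : Measure ℝ :=
  (keptMeasure F β Set.univ)⁻¹ • keptMeasure F β

theorem le_measure_threshold (F : Measure ℝ) [IsProbabilityMeasure F] {β : ℝ} (hβ : β ≤ 1) :
    ENNReal.ofReal β ≤ F {x | ‖x‖ₑ ≤ truncThreshold F β} := by
  have hne : ({t | ENNReal.ofReal β ≤ F {x | ‖x‖ₑ ≤ t}} : Set ℝ≥0∞).Nonempty :=
    ⟨⊤, by simpa using hβ⟩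
  obtain ⟨u, hu, hut, hmem⟩ := exists_seq_tendsto_sInf hne (OrderBot.bddBelow _)
  change Tendsto u atTop (𝓝 (truncThreshold F β)) at hut
  have hset : {x : ℝ | ‖x‖ₑ ≤ truncThreshold F β} = ⋂ n, {x : ℝ | ‖x‖ₑ ≤ u n} := by
    ext x
    simp only [Set.mem_ofPred_eq, Set.mem_iInter]
    exact ⟨fun h n => h.trans (sInf_le (hmem n)), fun h => ge_of_tendsto' hut h⟩
  have hlim := tendsto_measure_iInter_atTop (μ := F) (s := fun n => {x : ℝ | ‖x‖ₑ ≤ u n})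
    (fun n => (measurableSet_le measurable_enorm measurable_const).nullMeasurableSet)
    (fun a b hab x hx => le_trans hx (hu hab)) ⟨0, measure_ne_top _ _⟩
  rw [hset]
  exact ge_of_tendsto' hlim hmem

theorem measure_lt_threshold_le (F : Measure ℝ) (β : ℝ) :
    F {x | ‖x‖ₑ < truncThreshold F β} ≤ ENNReal.ofReal β := by
  rcases eq_bot_or_bot_lt (truncThreshold F β) with h0 | h0
  · rw [h0]
    simp
  obtain ⟨u, hu, hlt, hut⟩ := exists_seq_strictMono_tendsto' h0
  have hset : {x : ℝ | ‖x‖ₑ < truncThreshold F β} = ⋃ n, {x : ℝ | ‖x‖ₑ ≤ u n} := by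
    ext x
    simp only [Set.mem_ofPred_eq, Set.mem_iUnion]
    constructor
    · intro h
      obtain ⟨n, hn⟩ := (hut.eventually (lt_mem_nhds h)).exists
      exact ⟨n, hn.le⟩
    · rintro ⟨n, hn⟩
      exact hn.trans_lt (hlt n).2
  have hmono : Monotone fun n => {x : ℝ | ‖x‖ₑ ≤ u n} :=
    fun a b hab x hx => le_trans hx (hu.monotone hab)
  rw [hset, hmono.measure_iUnion]
  refine iSup_le fun n => ?_
  by_contra! hn
  exact absurd (sInf_le (a := u n) hn.le) (not_le.2 (hlt n).2)

/-- The construction is the required one: `Pr{Z = 0} = β`. -/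
theorem keptMeasure_univ (F : Measure ℝ) [IsProbabilityMeasure F] {β : ℝ} (hβ : β ≤ 1) :
    keptMeasure F β Set.univ = ENNReal.ofReal β := by
  have h1 := le_measure_threshold F hβ
  have h2 := measure_lt_threshold_le F β
  have mlt : MeasurableSet {x : ℝ | ‖x‖ₑ < truncThreshold F β} :=
    measurableSet_lt measurable_enorm measurable_const
  have meq : MeasurableSet {x : ℝ | ‖x‖ₑ = truncThreshold F β} :=
    measurableSet_eq_fun measurable_enorm measurable_const
  have hdisj : Disjoint {x : ℝ | ‖x‖ₑ < truncThreshold F β}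
      {x : ℝ | ‖x‖ₑ = truncThreshold F β} :=
    Set.disjoint_left.2 fun x hx hx' => (ne_of_lt hx) hx'
  have hun : F {x | ‖x‖ₑ ≤ truncThreshold F β} = F {x | ‖x‖ₑ < truncThreshold F β}
      + F {x | ‖x‖ₑ = truncThreshold F β} := by
    rw [← measure_union hdisj meq]
    congr 1
    ext x
    exact le_iff_lt_or_eq (a := ‖x‖ₑ) (b := truncThreshold F β)
  have hk : keepProb F β = fun x =>
      ({x : ℝ | ‖x‖ₑ < truncThreshold F β}.indicator (fun _ => (1 : ℝ≥0∞)) x)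
      + ({x : ℝ | ‖x‖ₑ = truncThreshold F β}.indicator
          (fun _ => 1 - truncTieProb F β) x) := by
    funext x
    simp only [keepProb, Set.indicator, Set.mem_ofPred_eq]
    by_cases hx : ‖x‖ₑ < truncThreshold F β
    · simp [hx, hx.ne]
    · simp [hx]
  rw [keptMeasure, withDensity_apply _ MeasurableSet.univ, Measure.restrict_univ, hk,
    lintegral_add_left (measurable_const.indicator mlt), lintegral_indicator_const mlt,
    lintegral_indicator_const meq, one_mul]
  rw [hun] at h1
  set a := F {x | ‖x‖ₑ < truncThreshold F β} with ha
  set b := F {x | ‖x‖ₑ = truncThreshold F β} with hb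
  have hq : ENNReal.ofReal β - a ≤ b := tsub_le_iff_left.2 h1
  have hbt : b ≠ ⊤ := measure_ne_top _ _
  have htie : 1 - truncTieProb F β = (ENNReal.ofReal β - a) / b := by
    rw [truncTieProb, ← ha, ← hb]
    exact ENNReal.sub_sub_cancel ENNReal.one_ne_top (ENNReal.div_le_of_le_mul (by simpa using hq))
  rw [htie]
  by_cases hb0 : b = 0
  · rw [hb0] at h1 ⊢
    simpa using le_antisymm h2 (by simpa using h1)
  · rw [ENNReal.div_mul_cancel hb0 hbt, add_tsub_cancel_of_le h2]

end SparsityRecovery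

end

noncomputable section

namespace SparsityRecovery

/-! Fix `β` and a vector `x` of the source, and let a genie reveal the nonzero entries indexed by a
set `T`, so that only about `βΩn` entries, distributed like `F_β`, remain to be located. Average
over all permutations `σ` of the coordinates, and compare the true law `N(A(x ∘ σ), I)` of the
observation with a reference law `N(A(g ∘ σ), vI)`, where `g` agrees with `x` on `T` and vanishes
elsewhere, up to a common additive constant. Since `g` is constant off `T`, the reference law
carries no information on the other positions: under it any estimator succeeds with average
probability at most `1/K`, where `K` is the number of remaining patterns divided by the number of
them close to one estimate (`sum_measureReal_success_le`).

A variational inequality of Donsker–Varadhan type (`log_mul_measureReal_pi_gaussianReal_le`) carries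
this bound to the true law at the price of the Gaussian divergence. With `v = 1 + w`, where `w`
bounds the variance per coordinate of the unrevealed part, the trace normalization makes this price
at most `(m/2) log(1 + w)` on average (`sum_mulVec_sq_le`). The outcome is the nonasymptotic
converse `log K · (1 - ε) ≤ 1 + (m/2) log(1 + w)` of `log_mul_one_sub_le`, obtained without entropy
or Fano's inequality.

For the limit, vectors of the source are built from block averages of quantile functions
(`exists_source_vector`), which gives `w → V(βΩ, F_β)`. Stirling's formula and a Chernoff bound
(`exists_tendsto_le_log_choose`, `exists_pattern_count_bound`) show that `log K / n` is
asymptotically at least the numerator of the theorem without its factor 2 (`mul_encodingRate_eq`).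
The error is uniform over permutations because the source contains every rearrangement
(`exists_uniform_error`). -/

/-! ### Gaussian change of measure. -/

theorem pi_withDensity_prod {ι : Type*} [Fintype ι] {X : ι → Type*}
    [∀ i, MeasurableSpace (X i)] (μ ν : ∀ i, Measure (X i)) [∀ i, IsProbabilityMeasure (μ i)]
    [∀ i, IsProbabilityMeasure (ν i)] (f : ∀ i, X i → ℝ≥0∞) (hf : ∀ i, Measurable (f i))
    (hν : ∀ i, ν i = (μ i).withDensity (f i)) :
    Measure.pi ν = (Measure.pi μ).withDensity fun x => ∏ i, f i (x i) := by
  refine Measure.pi_eq fun s hs => ?_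
  rw [withDensity_apply _ (MeasurableSet.univ_pi hs),
    ← lintegral_indicator (MeasurableSet.univ_pi hs)]
  have hind : ∀ x : ∀ i, X i, (Set.univ.pi s).indicator (fun x => ∏ i, f i (x i)) x
      = ∏ i, (s i).indicator (f i) (x i) := by
    intro x
    by_cases hx : x ∈ Set.univ.pi s
    · rw [Set.indicator_of_mem hx]
      exact Finset.prod_congr rfl fun i _ => (Set.indicator_of_mem (hx i trivial) _).symm
    · rw [Set.indicator_of_notMem hx]
      simp only [Set.mem_pi, Set.mem_univ, true_implies, not_forall] at hx
      obtain ⟨i, hi⟩ := hx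
      exact (Finset.prod_eq_zero (Finset.mem_univ i) (Set.indicator_of_notMem hi _)).symm
  simp_rw [hind]
  have hmeas : ∀ i, Measurable ((s i).indicator (f i)) := fun i => (hf i).indicator (hs i)
  rw [lintegral_prod_eq_prod_lintegral_of_indepFun Finset.univ
    (fun i (x : ∀ i, X i) => (s i).indicator (f i) (x i))
    (iIndepFun_pi fun i => (hmeas i).aemeasurable)
    (fun i => (hmeas i).comp (measurable_pi_apply i))]
  refine Finset.prod_congr rfl fun i _ => ?_
  rw [hν i, withDensity_apply _ (hs i), ← lintegral_indicator (hs i)]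
  exact (measurePreserving_eval μ i).lintegral_comp (hmeas i)

theorem gaussianReal_eq_withDensity (c d : ℝ) {v : ℝ≥0} (hv : v ≠ 0) :
    gaussianReal d v = (gaussianReal c 1).withDensity fun y =>
      ENNReal.ofReal (Real.exp ((y - c) ^ 2 / 2 - (y - d) ^ 2 / (2 * v) - Real.log v / 2)) := by
  rw [gaussianReal_of_var_ne_zero _ hv, gaussianReal_of_var_ne_zero _ one_ne_zero,
    ← withDensity_mul _ (measurable_gaussianPDF _ _) (by fun_prop)]
  congr 1
  funext y
  have hv' : (0 : ℝ) < v := by positivity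
  simp only [gaussianPDF, Pi.mul_apply]
  rw [← ENNReal.ofReal_mul (gaussianPDFReal_nonneg _ _ _)]
  congr 1
  simp only [gaussianPDFReal, NNReal.coe_one]
  have hs : Real.exp (-(Real.log v / 2)) = (√(v : ℝ))⁻¹ := by
    rw [Real.exp_neg, Real.sqrt_eq_rpow, Real.rpow_def_of_pos hv']
    ring_nf
  rw [mul_assoc (√(2 * Real.pi * 1))⁻¹, ← Real.exp_add]
  have : -(y - c) ^ 2 / (2 * 1) + ((y - c) ^ 2 / 2 - (y - d) ^ 2 / (2 * v) - Real.log v / 2)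
    = -(y - d) ^ 2 / (2 * v) + -(Real.log v / 2) := by ring
  rw [this, Real.exp_add, hs, mul_one, Real.sqrt_mul (by positivity)]
  rw [mul_inv]
  ring

theorem lintegral_sq_gaussianReal (c d : ℝ) :
    ∫⁻ y, ENNReal.ofReal ((y - d) ^ 2) ∂gaussianReal c 1 = ENNReal.ofReal (1 + (c - d) ^ 2) := by
  have hL : MemLp (fun y : ℝ => y - d) 2 (gaussianReal c 1) :=
    (memLp_id_gaussianReal 2).sub (memLp_const d)
  have hvar : Var[fun y : ℝ => y - d; gaussianReal c 1] = 1 := by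
    rw [variance_sub_const (by fun_prop), variance_fun_id_gaussianReal]
    simp
  have hmean : ∫ y, (y - d) ∂gaussianReal c 1 = c - d := by
    have hi : Integrable (fun y : ℝ => y) (gaussianReal c 1) :=
      (memLp_id_gaussianReal 1).integrable le_rfl
    rw [integral_sub hi (integrable_const _)]
    simp
  rw [variance_eq_sub hL] at hvar
  rw [← ofReal_integral_eq_lintegral_ofReal hL.integrable_sq (ae_of_all _ fun _ => sq_nonneg _)]
  congr 1
  have h2 : ∫ y, (y - d) ^ 2 ∂gaussianReal c 1 - (∫ y, (y - d) ∂gaussianReal c 1) ^ 2 = 1 := hvar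
  rw [hmean] at h2
  linarith

theorem lintegral_sum_sq_pi_gaussianReal {m : ℕ} (c d : Fin m → ℝ) {r : ℝ} (hr : 0 ≤ r) :
    ∫⁻ y, ENNReal.ofReal (r * ∑ i, (y i - d i) ^ 2) ∂(Measure.pi fun i => gaussianReal (c i) 1)
      = ENNReal.ofReal (r * (m + ∑ i, (c i - d i) ^ 2)) := by
  have h1 : ∀ y : Fin m → ℝ, ENNReal.ofReal (r * ∑ i, (y i - d i) ^ 2)
      = ENNReal.ofReal r * ∑ i, ENNReal.ofReal ((y i - d i) ^ 2) := fun y => by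
    rw [ENNReal.ofReal_mul hr, ENNReal.ofReal_sum_of_nonneg fun _ _ => sq_nonneg _]
  simp_rw [h1]
  rw [lintegral_const_mul _ (by fun_prop), lintegral_finsetSum _ (by fun_prop)]
  have h2 : ∀ i, ∫⁻ y, ENNReal.ofReal ((y i - d i) ^ 2)
      ∂(Measure.pi fun i => gaussianReal (c i) 1) = ENNReal.ofReal (1 + (c i - d i) ^ 2) :=
    fun i => by
      rw [← lintegral_sq_gaussianReal]
      exact (measurePreserving_eval (fun i => gaussianReal (c i) 1) i).lintegral_comp
        (f := fun y : ℝ => ENNReal.ofReal ((y - d i) ^ 2)) (by fun_prop)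
  simp_rw [h2]
  rw [← ENNReal.ofReal_sum_of_nonneg fun _ _ => by positivity, ← ENNReal.ofReal_mul hr,
    Finset.sum_add_distrib]
  simp

/-- Change of measure between the Gaussian laws `N(c, I)` and `N(d, v I)`. -/
theorem log_mul_measureReal_pi_gaussianReal_le {m : ℕ} (c d : Fin m → ℝ) {v : ℝ≥0}
    (hv : 1 ≤ v) {K : ℝ} (hK : 1 ≤ K) {S : Set (Fin m → ℝ)} (hS : MeasurableSet S) :
    Real.log K * (Measure.pi fun i => gaussianReal (c i) 1).real S + m / 2
      ≤ K * (Measure.pi fun i => gaussianReal (d i) v).real S + m / 2 * Real.log v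
        + (m + ∑ i, (c i - d i) ^ 2) / (2 * v) := by
  have hv0 : v ≠ 0 := (zero_lt_one.trans_le hv).ne'
  have hvpos : (0 : ℝ) < v := by positivity
  have hlogv : 0 ≤ Real.log v := Real.log_nonneg (by exact_mod_cast hv)
  have hlogK : 0 ≤ Real.log K := Real.log_nonneg hK
  set μ := Measure.pi fun i => gaussianReal (c i) 1 with hμ
  set ν := Measure.pi fun i => gaussianReal (d i) v with hν
  set e : (Fin m → ℝ) → ℝ := fun y =>
    ∑ i, ((y i - c i) ^ 2 / 2 - (y i - d i) ^ 2 / (2 * v) - Real.log v / 2) with he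
  have he' : ∀ y, e y = 2⁻¹ * ∑ i, (y i - c i) ^ 2 - (2 * v : ℝ)⁻¹ * ∑ i, (y i - d i) ^ 2
      - m / 2 * Real.log v := fun y => by
    simp only [he, Finset.sum_sub_distrib, ← Finset.sum_div]
    simp
    ring
  have hemeas : Measurable e := by fun_prop
  have hden : ν = μ.withDensity fun y => ENNReal.ofReal (Real.exp (e y)) := by
    rw [hν, hμ, pi_withDensity_prod (fun i => gaussianReal (c i) 1) _ _ (fun i => by fun_prop)
      fun i => gaussianReal_eq_withDensity (c i) (d i) hv0]
    congr 1
    funext y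
    rw [← ENNReal.ofReal_prod_of_nonneg fun _ _ => (Real.exp_pos _).le, ← Real.exp_sum]
  -- Each term is moved to the side where it is nonnegative, so the inequality can be integrated in
  -- `ℝ≥0∞`.
  have hpt : ∀ y, S.indicator (fun _ => ENNReal.ofReal (Real.log K)) y + (1
      + ENNReal.ofReal (2⁻¹ * ∑ i, (y i - c i) ^ 2))
      ≤ ENNReal.ofReal (Real.exp (e y)) * (1 + S.indicator (fun _ => ENNReal.ofReal K) y)
        + (ENNReal.ofReal (m / 2 * Real.log v)
        + ENNReal.ofReal ((2 * v : ℝ)⁻¹ * ∑ i, (y i - d i) ^ 2)) := by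
    intro y
    have hA : 0 ≤ ∑ i, (y i - c i) ^ 2 := Finset.sum_nonneg fun _ _ => sq_nonneg _
    have hB : 0 ≤ ∑ i, (y i - d i) ^ 2 := Finset.sum_nonneg fun _ _ => sq_nonneg _
    have hee := he' y
    rw [← ENNReal.ofReal_one]
    by_cases hy : y ∈ S
    · rw [Set.indicator_of_mem hy, Set.indicator_of_mem hy,
        ← ENNReal.ofReal_add (by positivity) (by positivity),
        ← ENNReal.ofReal_add (by positivity) (by positivity),
        ← ENNReal.ofReal_add (by positivity) (by positivity),
        ← ENNReal.ofReal_mul (by positivity),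
        ← ENNReal.ofReal_add (by positivity) (by positivity),
        ← ENNReal.ofReal_add (by positivity) (by positivity)]
      refine ENNReal.ofReal_le_ofReal ?_
      -- This is `1 + t ≤ exp t` at `t = e + log K · 1_S`: the exponential integrates to at most `1
      -- + K ν(S)`, and minus the mean of `e` under `μ` is the divergence.
      have h := Real.add_one_le_exp (Real.log K + e y)
      rw [Real.exp_add, Real.exp_log (by positivity)] at h
      nlinarith [Real.exp_pos (e y)]
    · rw [Set.indicator_of_notMem hy, Set.indicator_of_notMem hy, zero_add, add_zero,
        ← ENNReal.ofReal_add (by positivity) (by positivity),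
        ← ENNReal.ofReal_add (by positivity) (by positivity),
        ← ENNReal.ofReal_mul (by positivity),
        ← ENNReal.ofReal_add (by positivity) (by positivity)]
      refine ENNReal.ofReal_le_ofReal ?_
      have h := Real.add_one_le_exp (e y)
      linarith
  have hint := lintegral_mono (μ := μ) hpt
  rw [lintegral_add_left (measurable_const.indicator hS), lintegral_indicator_const hS,
    lintegral_add_left measurable_const, lintegral_const, measure_univ,
    lintegral_sum_sq_pi_gaussianReal c c (by positivity),
    lintegral_add_left (by fun_prop (disch := exact hS)), lintegral_add_left measurable_const,
    lintegral_const, measure_univ, lintegral_sum_sq_pi_gaussianReal c d (by positivity)] at hint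
  have hQ : ∫⁻ y, ENNReal.ofReal (Real.exp (e y)) * (1 + S.indicator (fun _ => ENNReal.ofReal K) y)
      ∂μ = 1 + ENNReal.ofReal K * ν S := by
    have h := lintegral_withDensity_eq_lintegral_mul μ
      (f := fun y => ENNReal.ofReal (Real.exp (e y))) (by fun_prop)
      (g := fun y => 1 + S.indicator (fun _ => ENNReal.ofReal K) y)
      (measurable_const.add (measurable_const.indicator hS))
    rw [← hden] at h
    simp only [Pi.mul_apply] at h
    rw [← h, lintegral_add_left measurable_const, lintegral_const, measure_univ,
      lintegral_indicator_const hS, one_mul]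
  rw [hQ] at hint
  rw [← ENNReal.ofReal_toReal (measure_ne_top μ S), ← ENNReal.ofReal_toReal (measure_ne_top ν S),
    ← ENNReal.ofReal_one, ← ENNReal.ofReal_mul hlogK, ← ENNReal.ofReal_mul (by positivity),
    ← ENNReal.ofReal_mul (by positivity), ← ENNReal.ofReal_mul (by positivity),
    ← ENNReal.ofReal_add (by positivity) (by positivity),
    ← ENNReal.ofReal_add (by positivity) (by positivity),
    ← ENNReal.ofReal_add (by positivity) (by positivity),
    ← ENNReal.ofReal_add (by positivity) (by positivity),
    ← ENNReal.ofReal_add (by positivity) (by positivity),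
    ENNReal.ofReal_le_ofReal_iff (by positivity)] at hint
  simp only [sub_self, ne_eq, OfNat.ofNat_ne_zero, not_false_eq_true, zero_pow,
    Finset.sum_const_zero, add_zero, mul_one] at hint
  simp only [Measure.real]
  rw [div_eq_inv_mul ((m : ℝ) + _)]
  linarith

/-! ### Uniform permutations: second moments and supports. -/

/-- By symmetry the covariance of the entries of `z ∘ σ` has one value on the diagonal and one off
it, and `∑ z = 0` makes the latter nonpositive. The quadratic form is then a multiple of `∑ a²`
minus a multiple of `(∑ a)²`, and the last term is dropped. -/
theorem sum_perm_sq_le {n : ℕ} (hn : 2 ≤ n) (z : Fin n → ℝ) (hz : ∑ i, z i = 0)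
    (a : Fin n → ℝ) :
    ∑ σ : Equiv.Perm (Fin n), (∑ i, a i * z (σ i)) ^ 2
      ≤ Nat.factorial n * ((∑ i, z i ^ 2) / ((n : ℝ) - 1) * ∑ i, a i ^ 2) := by
  have hn' : (2 : ℝ) ≤ n := by exact_mod_cast hn
  have hfact : (Fintype.card (Equiv.Perm (Fin n)) : ℝ) = Nat.factorial n := by
    rw [Fintype.card_perm, Fintype.card_fin]
  set D : ℝ := Nat.factorial n * (∑ i, z i ^ 2) / n with hD
  set E : Fin n → Fin n → ℝ := fun i j => ∑ σ : Equiv.Perm (Fin n), z (σ i) * z (σ j) with hE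
  have hswap : ∀ (π : Equiv.Perm (Fin n)) i j, E (π i) (π j) = E i j := fun π i j => by
    simp only [hE]
    exact Fintype.sum_equiv (Equiv.mulRight π) _ _ fun σ => by simp
  have hdiag : ∀ i, E i i = D := by
    intro i
    have h1 : ∀ j, E j j = E i i := fun j => by
      have := hswap (Equiv.swap i j) i i
      rwa [Equiv.swap_apply_left] at this
    have h2 : ∑ j, E j j = n * E i i := by simp [h1]
    have h3 : ∑ j, E j j = Nat.factorial n * ∑ i, z i ^ 2 := by
      simp only [hE]
      rw [Finset.sum_comm]
      have : ∀ σ : Equiv.Perm (Fin n), ∑ j, z (σ j) * z (σ j) = ∑ i, z i ^ 2 := fun σ => by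
        rw [← Equiv.sum_comp σ (fun i => z i ^ 2)]
        exact Finset.sum_congr rfl fun _ _ => by ring
      simp [this, ← hfact]
    rw [hD, ← h3, h2]
    field_simp
  have hoff : ∀ i j, i ≠ j → E i j = -D / ((n : ℝ) - 1) := by
    intro i j hij
    have h1 : ∀ l, i ≠ l → E i l = E i j := fun l hl => by
      have := hswap (Equiv.swap j l) i j
      rwa [Equiv.swap_apply_of_ne_of_ne hij hl, Equiv.swap_apply_left] at this
    have h2 : ∑ l, E i l = 0 := by
      simp only [hE]
      rw [Finset.sum_comm]
      refine Finset.sum_eq_zero fun σ _ => ?_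
      rw [← Finset.mul_sum, Equiv.sum_comp σ z, hz, mul_zero]
    rw [← Finset.add_sum_erase _ _ (Finset.mem_univ i), hdiag,
      Finset.sum_congr rfl fun l hl => h1 l (Finset.ne_of_mem_erase hl).symm,
      Finset.sum_const, Finset.card_erase_of_mem (Finset.mem_univ i), Finset.card_fin,
      nsmul_eq_mul, Nat.cast_sub (by lia), Nat.cast_one] at h2
    rw [eq_div_iff (by linarith)]
    linarith
  have hEij : ∀ i j, E i j = -D / ((n : ℝ) - 1) + if i = j then D * (n / ((n : ℝ) - 1)) else 0 := by
    intro i j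
    have : (n : ℝ) - 1 ≠ 0 := by linarith
    split_ifs with h
    · rw [← h, hdiag]
      field_simp
      ring
    · rw [hoff i j h, add_zero]
  have hexp : ∑ σ : Equiv.Perm (Fin n), (∑ i, a i * z (σ i)) ^ 2
      = ∑ i, ∑ j, a i * a j * E i j := by
    simp only [hE, Finset.mul_sum, sq, Finset.sum_mul]
    rw [Finset.sum_comm]
    refine Finset.sum_congr rfl fun i _ => ?_
    rw [Finset.sum_comm]
    exact Finset.sum_congr rfl fun j _ => Finset.sum_congr rfl fun σ _ => by ring
  have hsum : ∑ i, ∑ j, a i * a j * E i j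
      = -D / ((n : ℝ) - 1) * (∑ i, a i) ^ 2 + D * (n / ((n : ℝ) - 1)) * ∑ i, a i ^ 2 := by
    simp only [hEij, mul_add, Finset.sum_add_distrib, mul_ite, mul_zero, Finset.sum_ite_eq,
      Finset.mem_univ, if_true]
    congr 1
    · rw [sq, Finset.sum_mul_sum, Finset.mul_sum]
      refine Finset.sum_congr rfl fun i _ => ?_
      rw [Finset.mul_sum]
      exact Finset.sum_congr rfl fun j _ => by ring
    · rw [Finset.mul_sum]
      exact Finset.sum_congr rfl fun j _ => by ring
  have hD0 : 0 ≤ D := by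
    have : 0 ≤ ∑ i, z i ^ 2 := Finset.sum_nonneg fun _ _ => sq_nonneg _
    positivity
  have hneg : -D / ((n : ℝ) - 1) * (∑ i, a i) ^ 2 ≤ 0 :=
    mul_nonpos_of_nonpos_of_nonneg (div_nonpos_of_nonpos_of_nonneg (by linarith) (by linarith))
      (sq_nonneg _)
  have hDn : D * (n / ((n : ℝ) - 1)) = Nat.factorial n * ((∑ i, z i ^ 2) / ((n : ℝ) - 1)) := by
    rw [hD]
    field_simp
  rw [hexp, hsum, hDn, ← mul_assoc]
  linarith

theorem exists_perm_map_eq {ι : Type*} [Fintype ι] [DecidableEq ι] {s t : Finset ι}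
    (h : s.card = t.card) : ∃ π : Equiv.Perm ι, s.map π.toEmbedding = t := by
  refine ⟨(Finset.equivOfCardEq h).extendSubtype, ?_⟩
  refine Finset.eq_of_subset_of_card_le (fun x hx => ?_) (by simp [h])
  obtain ⟨y, hy, rfl⟩ := Finset.mem_map.1 hx
  exact Equiv.extendSubtype_mem (Finset.equivOfCardEq h) y hy

/-- The image of a fixed set under a uniform permutation is a uniform set of its size. -/
theorem choose_mul_sum_perm_map {ι : Type*} [Fintype ι] [DecidableEq ι] (s : Finset ι)
    (φ : Finset ι → ℕ) :
    (Fintype.card ι).choose s.card * ∑ τ : Equiv.Perm ι, φ (s.map τ.toEmbedding)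
      = (Fintype.card ι).factorial * ∑ t ∈ Finset.powersetCard s.card Finset.univ, φ t := by
  have h1 : ∀ t ∈ Finset.powersetCard s.card (Finset.univ : Finset ι),
      ∑ τ : Equiv.Perm ι, φ (t.map τ.toEmbedding)
        = ∑ τ : Equiv.Perm ι, φ (s.map τ.toEmbedding) := by
    intro t ht
    obtain ⟨π, rfl⟩ := exists_perm_map_eq (Finset.mem_powersetCard.1 ht).2.symm
    exact Fintype.sum_equiv (Equiv.mulRight π) _ _ fun τ => by
      congr 1
      rw [Finset.map_map]
      rfl
  have h2 : ∀ τ : Equiv.Perm ι,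
      ∑ t ∈ Finset.powersetCard s.card (Finset.univ : Finset ι), φ (t.map τ.toEmbedding)
        = ∑ t ∈ Finset.powersetCard s.card (Finset.univ : Finset ι), φ t := by
    intro τ
    refine Finset.sum_equiv (Equiv.finsetCongr τ) (fun t => ?_) fun t _ => ?_
    · simp [Finset.mem_powersetCard]
    · simp
  have h3 := Finset.sum_congr rfl h1
  rw [Finset.sum_comm, Finset.sum_congr rfl fun τ _ => h2 τ] at h3
  simp only [Finset.sum_const, Finset.card_powersetCard, Finset.card_univ, smul_eq_mul,
    Fintype.card_perm] at h3
  exact h3.symm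

theorem distortion_le_iff {n : ℕ} {s s' : Finset (Fin n)} (hs : 0 < s.card) (α : ℝ) :
    distortion s s' ≤ α ↔ ((s \ s').card : ℝ) ≤ α * s.card := by
  have hs' : (0 : ℝ) < s.card := by exact_mod_cast hs
  have h : ((s \ s').card : ℝ) + (s ∩ s').card = s.card := by
    exact_mod_cast Finset.card_sdiff_add_card_inter s s'
  rw [distortion, sub_le_comm, le_div_iff₀ hs']
  constructor <;> intro <;> linarith

theorem sparsityPattern_comp {n : ℕ} (x : Fin n → ℝ) (ρ : Equiv.Perm (Fin n)) :
    (sparsityPattern (x ∘ ρ)).map ρ.toEmbedding = sparsityPattern x := by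
  ext j
  simp only [sparsityPattern, Finset.mem_map_equiv, Finset.mem_filter, Finset.mem_univ, true_and,
    Function.comp_apply, Equiv.apply_symm_apply]

theorem card_sparsityPattern_comp {n : ℕ} (x : Fin n → ℝ) (ρ : Equiv.Perm (Fin n)) :
    (sparsityPattern (x ∘ ρ)).card = (sparsityPattern x).card := by
  rw [← sparsityPattern_comp x ρ, Finset.card_map]

theorem card_sparsityPattern_comp_sdiff {n : ℕ} (x : Fin n → ℝ) (ρ : Equiv.Perm (Fin n))
    (s : Finset (Fin n)) :
    (sparsityPattern (x ∘ ρ) \ s).card = (sparsityPattern x \ s.map ρ.toEmbedding).card := by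
  rw [← sparsityPattern_comp x ρ, ← Finset.card_map ρ.toEmbedding]
  congr 1
  ext j
  simp

/-- A permutation fixing `T` does not affect the misses inside `T`; outside `T`, moving `U` by `τ`
amounts to moving `S` by `τ⁻¹`. -/
theorem card_sdiff_map_ofSubtype {n : ℕ} {S T : Finset (Fin n)} (hT : T ⊆ S)
    (U : Finset (Fin n)) (τ : Equiv.Perm {i // i ∉ T}) :
    (S \ U.map (Equiv.Perm.ofSubtype τ).toEmbedding).card
      = (T \ U).card + ((S.subtype (· ∉ T)).map τ⁻¹.toEmbedding \ U.subtype (· ∉ T)).card := by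
  rw [← Finset.card_filter_add_card_filter_not (s := S \ _) (· ∈ T)]
  congr 1
  · congr 1
    ext j
    simp only [Finset.mem_filter, Finset.mem_sdiff, Finset.mem_map_equiv]
    constructor
    · rintro ⟨⟨_, h2⟩, h3⟩
      refine ⟨h3, fun h => h2 ?_⟩
      rwa [← Equiv.Perm.inv_def, ← map_inv, Equiv.Perm.ofSubtype_apply_of_not_mem _ (by simpa)]
    · rintro ⟨h1, h2⟩
      refine ⟨⟨hT h1, fun h => h2 ?_⟩, h1⟩
      rwa [← Equiv.Perm.inv_def, ← map_inv,
        Equiv.Perm.ofSubtype_apply_of_not_mem _ (by simpa)] at h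
  · rw [← Finset.card_subtype, ← Finset.card_map τ⁻¹.toEmbedding]
    congr 1
    ext j
    simp only [Finset.mem_map_equiv, Finset.mem_subtype, Finset.mem_sdiff]
    rw [← Equiv.Perm.inv_def, inv_inv, ← Equiv.Perm.inv_def, ← map_inv,
      Equiv.Perm.ofSubtype_apply_coe]
    simp

/-- Among the permutations that fix `T`, few move the support of `x` close to a given set. -/
theorem mul_card_perm_distortion_le {n b : ℕ} {x : Fin n → ℝ} {T : Finset (Fin n)}
    (hT : T ⊆ sparsityPattern x) (hb : T.card + b = (sparsityPattern x).card)
    (hpos : 0 < (sparsityPattern x).card) {α K : ℝ}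
    (hK : ∀ (U : Finset {i // i ∉ T}) (a : ℕ), U.card = b + a →
      K * ((Finset.powersetCard b Finset.univ).filter fun t : Finset {i // i ∉ T} =>
        ((a + (t \ U).card : ℕ) : ℝ) ≤ α * (sparsityPattern x).card).card
        ≤ (Fintype.card {i // i ∉ T}).choose b)
    (σ : Equiv.Perm (Fin n)) {s : Finset (Fin n)} (hs : s.card = (sparsityPattern x).card) :
    K * (Finset.univ.filter fun τ : Equiv.Perm {i // i ∉ T} =>
        distortion (sparsityPattern (x ∘ ⇑(Equiv.Perm.ofSubtype τ * σ))) s ≤ α).card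
      ≤ Fintype.card (Equiv.Perm {i // i ∉ T}) := by
  set U := s.map σ.toEmbedding with hU
  set V := U.subtype (· ∉ T) with hV
  set B := (sparsityPattern x).subtype (· ∉ T) with hB
  have hBcard : B.card = b := by
    rw [hB, Finset.card_subtype]
    have h1 := Finset.card_filter_add_card_filter_not (s := sparsityPattern x) (· ∈ T)
    have h2 : (sparsityPattern x).filter (· ∈ T) = T := by
      rw [Finset.filter_mem_eq_inter]
      exact Finset.inter_eq_right.2 hT
    rw [h2] at h1
    lia
  -- The estimate has the size of the support, so the elements of `T` that it misses reappear as an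
  -- excess outside `T`. This is the `a` of `hK`.
  have hVcard : V.card = b + (T \ U).card := by
    rw [hV, Finset.card_subtype]
    have h1 := Finset.card_filter_add_card_filter_not (s := U) (· ∈ T)
    rw [Finset.filter_mem_eq_inter, hU, Finset.card_map, hs, ← hU] at h1
    have h2 := Finset.card_sdiff_add_card_inter T U
    rw [Finset.inter_comm] at h2
    lia
  set φ : Finset {i // i ∉ T} → ℕ := fun t =>
    if (((T \ U).card + (t \ V).card : ℕ) : ℝ) ≤ α * (sparsityPattern x).card then 1 else 0 with hφ
  have hcount : (Finset.univ.filter fun τ : Equiv.Perm {i // i ∉ T} =>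
        distortion (sparsityPattern (x ∘ ⇑(Equiv.Perm.ofSubtype τ * σ))) s ≤ α).card
      = ∑ τ : Equiv.Perm {i // i ∉ T}, φ (B.map τ.toEmbedding) := by
    -- Summation over inverses cancels the inverse in `card_sdiff_map_ofSubtype`.
    rw [Finset.card_filter, ← Equiv.sum_comp (Equiv.inv _)]
    refine Finset.sum_congr rfl fun τ _ => ?_
    have h1 : s.map (Equiv.Perm.ofSubtype τ⁻¹ * σ).toEmbedding
        = U.map (Equiv.Perm.ofSubtype τ⁻¹).toEmbedding := by
      rw [hU, Finset.map_map]
      rfl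
    have h2 := card_sdiff_map_ofSubtype hT U τ⁻¹
    rw [inv_inv] at h2
    simp only [hφ, Equiv.inv_apply]
    refine if_congr ?_ rfl rfl
    rw [distortion_le_iff (by rwa [card_sparsityPattern_comp]), card_sparsityPattern_comp,
      card_sparsityPattern_comp_sdiff, h1, h2]
  have hsum := choose_mul_sum_perm_map B φ
  rw [hBcard, ← hcount] at hsum
  have hφsum : ∑ t ∈ Finset.powersetCard b Finset.univ, φ t
      = ((Finset.powersetCard b Finset.univ).filter fun t : Finset {i // i ∉ T} =>
        (((T \ U).card + (t \ V).card : ℕ) : ℝ) ≤ α * (sparsityPattern x).card).card := by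
    rw [Finset.card_filter]
  rw [hφsum] at hsum
  have hk := hK V _ hVcard
  have hchoose : 0 < (Fintype.card {i // i ∉ T}).choose b := by
    refine Nat.choose_pos ?_
    rw [← hBcard]
    exact Finset.card_le_univ _
  rw [Fintype.card_perm]
  have hsum' := congrArg (Nat.cast : ℕ → ℝ) hsum
  rw [Nat.cast_mul, Nat.cast_mul] at hsum'
  have hc : (0 : ℝ) < ((Fintype.card {i // i ∉ T}).choose b : ℕ) := by exact_mod_cast hchoose
  refine le_of_mul_le_mul_left ?_ hc
  rw [mul_left_comm, hsum', mul_left_comm, mul_comm _ ((Fintype.card _).factorial : ℝ)]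
  exact mul_le_mul_of_nonneg_left hk (by positivity)

/-! ### The nonasymptotic converse. -/

theorem measurableSet_distortion_le {m n : ℕ} (est : Estimator m n) (k : ℕ)
    (s : Finset (Fin n)) (α : ℝ) :
    MeasurableSet {p : (Fin m → ℝ) × Matrix (Fin m) (Fin n) ℝ |
      distortion s (est.toFun p.1 p.2 k) ≤ α} := by
  have : {p : (Fin m → ℝ) × Matrix (Fin m) (Fin n) ℝ | distortion s (est.toFun p.1 p.2 k) ≤ α}
      = ⋃ t ∈ {t : Finset (Fin n) | distortion s t ≤ α}, {p | est.toFun p.1 p.2 k = t} := by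
    ext p
    simp
  rw [this]
  exact MeasurableSet.biUnion (Set.to_countable _) fun t _ => est.measurableSet_eq k t

theorem measurableSet_section_distortion_le {m n : ℕ} (est : Estimator m n) (k : ℕ)
    (s : Finset (Fin n)) (α : ℝ) (A : Matrix (Fin m) (Fin n) ℝ) :
    MeasurableSet {y : Fin m → ℝ | distortion s (est.toFun y A k) ≤ α} := by
  have h : Measurable fun y : Fin m → ℝ => (y, A) := measurable_prodMk_right
  have h' := h (measurableSet_distortion_le est k s α)
  simpa only [Set.preimage_ofPred_eq] using h'

/-- The sum is the integral of the number of sets that contain a given point. -/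
theorem sum_measureReal_le {ι Ω : Type*} [Fintype ι] [MeasurableSpace Ω] (Q : Measure Ω)
    [IsProbabilityMeasure Q] (S : ι → Set Ω) (hS : ∀ i, MeasurableSet (S i)) {B : ℝ}
    (hB : ∀ (y : Ω) (I : Finset ι), (∀ i, i ∈ I ↔ y ∈ S i) → (I.card : ℝ) ≤ B) :
    ∑ i, Q.real (S i) ≤ B := by
  classical
  have h1 : ∀ i, Q.real (S i) = ∫ y, (S i).indicator 1 y ∂Q := fun i =>
    (integral_indicator_one (hS i)).symm
  have hint : ∀ i, Integrable ((S i).indicator (1 : Ω → ℝ)) Q := fun i =>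
    (integrable_const (1 : ℝ)).indicator (hS i)
  simp_rw [h1]
  rw [← integral_finsetSum _ fun i _ => hint i]
  calc ∫ y, ∑ i, (S i).indicator (1 : Ω → ℝ) y ∂Q ≤ ∫ _, B ∂Q := by
        refine integral_mono (integrable_finsetSum _ fun i _ => hint i) (integrable_const _)
          fun y => ?_
        refine le_trans (le_of_eq ?_) (hB y (Finset.univ.filter fun i => y ∈ S i) (by simp))
        simp [Set.indicator_apply]
    _ = B := by simp

theorem sum_mulVec_sq_le {m n : ℕ} (hn : 2 ≤ n) (z : Fin n → ℝ) (hz : ∑ i, z i = 0)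
    (A : Matrix (Fin m) (Fin n) ℝ) :
    ∑ σ : Equiv.Perm (Fin n), ∑ r, (A *ᵥ (z ∘ σ)) r ^ 2
      ≤ Nat.factorial n * ((∑ i, z i ^ 2) / ((n : ℝ) - 1) * (A * Aᵀ).trace) := by
  have htr : (A * Aᵀ).trace = ∑ r, ∑ i, A r i ^ 2 := by
    simp [Matrix.trace, Matrix.mul_apply, sq]
  rw [Finset.sum_comm, htr, Finset.mul_sum, Finset.mul_sum]
  refine Finset.sum_le_sum fun r _ => ?_
  simpa [Matrix.mulVec, dotProduct] using sum_perm_sq_le hn z hz (A r)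

-- Since `g` is constant off `T`, the reference law is unchanged when `σ` is multiplied on the left
-- by a permutation fixing `T`. Over such a family of permutations the law is fixed and each
-- observation yields a single estimate, so the bound on the number of permutations with nearby
-- support applies.
set_option maxHeartbeats 400000 in
theorem sum_measureReal_success_le {m n b : ℕ} (est : Estimator m n)
    (A : Matrix (Fin m) (Fin n) ℝ) {x g : Fin n → ℝ} {T : Finset (Fin n)}
    (hT : T ⊆ sparsityPattern x) (hb : T.card + b = (sparsityPattern x).card)
    (hpos : 0 < (sparsityPattern x).card) (hg : ∀ i j, i ∉ T → j ∉ T → g i = g j)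
    {α K : ℝ} (hKpos : 0 < K)
    (hK : ∀ (U : Finset {i // i ∉ T}) (a : ℕ), U.card = b + a →
      K * ((Finset.powersetCard b Finset.univ).filter fun t : Finset {i // i ∉ T} =>
        ((a + (t \ U).card : ℕ) : ℝ) ≤ α * (sparsityPattern x).card).card
        ≤ (Fintype.card {i // i ∉ T}).choose b) (v : ℝ≥0) :
    K * ∑ σ : Equiv.Perm (Fin n),
      (Measure.pi fun r => gaussianReal ((A *ᵥ (g ∘ σ)) r) v).real
        {y | distortion (sparsityPattern (x ∘ σ))
          (est.toFun y A (sparsityPattern x).card) ≤ α} ≤ Nat.factorial n := by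
  set H := Equiv.Perm {i // i ∉ T}
  set k := (sparsityPattern x).card with hk
  set S : Equiv.Perm (Fin n) → Set (Fin m → ℝ) := fun σ =>
    {y | distortion (sparsityPattern (x ∘ σ)) (est.toFun y A k) ≤ α} with hS
  set Q : Equiv.Perm (Fin n) → Measure (Fin m → ℝ) := fun σ =>
    Measure.pi fun r => gaussianReal ((A *ᵥ (g ∘ σ)) r) v with hQ
  have hSmeas : ∀ σ, MeasurableSet (S σ) := fun σ =>
    measurableSet_section_distortion_le est k _ α A
  have hgτ : ∀ τ : H, g ∘ ⇑(Equiv.Perm.ofSubtype τ) = g := by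
    intro τ
    funext i
    by_cases hi : i ∈ T
    · simp [Equiv.Perm.ofSubtype_apply_of_not_mem τ (a := i) (by simpa)]
    · refine hg _ _ ?_ hi
      rw [Equiv.Perm.ofSubtype_apply_of_mem τ hi]
      exact (τ ⟨i, hi⟩).2
  have hQτ : ∀ (τ : H) σ, Q (Equiv.Perm.ofSubtype τ * σ) = Q σ := by
    intro τ σ
    simp only [hQ, Equiv.Perm.coe_mul, ← Function.comp_assoc, hgτ]
  have havg : (Fintype.card H : ℝ) * ∑ σ, (Q σ).real (S σ)
      = ∑ σ, ∑ τ : H, (Q σ).real (S (Equiv.Perm.ofSubtype τ * σ)) := by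
    rw [Finset.sum_comm]
    have : ∀ τ : H, ∑ σ, (Q σ).real (S (Equiv.Perm.ofSubtype τ * σ))
        = ∑ σ, (Q σ).real (S σ) := fun τ =>
      Fintype.sum_equiv (Equiv.mulLeft (Equiv.Perm.ofSubtype τ)) _ _ fun σ => by
        simp only [Equiv.coe_mulLeft]
        rw [hQτ]
    simp [this]
  have hle : ∀ σ, ∑ τ : H, (Q σ).real (S (Equiv.Perm.ofSubtype τ * σ))
      ≤ Fintype.card H / K := by
    intro σ
    refine sum_measureReal_le (Q σ) _ (fun τ => hSmeas _) fun y I hI => ?_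
    rw [le_div_iff₀' hKpos]
    have hkn : k ≤ n := by simpa using Finset.card_le_univ (sparsityPattern x)
    have h := mul_card_perm_distortion_le hT hb hpos hK σ (s := est.toFun y A k)
      (est.card_eq y A k hkn)
    have hIeq : I = Finset.univ.filter fun τ : H =>
        distortion (sparsityPattern (x ∘ ⇑(Equiv.Perm.ofSubtype τ * σ))) (est.toFun y A k) ≤ α := by
      ext τ
      rw [hI τ, Finset.mem_filter]
      simp only [hS, Set.mem_ofPred_eq, Finset.mem_univ, true_and]
    rw [hIeq]
    exact h
  have hH : (0 : ℝ) < Fintype.card H := by exact_mod_cast Fintype.card_pos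
  have hfact : (Fintype.card (Equiv.Perm (Fin n)) : ℝ) = Nat.factorial n := by
    rw [Fintype.card_perm, Fintype.card_fin]
  have hfin : (Fintype.card H : ℝ) * ∑ σ, (Q σ).real (S σ)
      ≤ Nat.factorial n * (Fintype.card H / K) := by
    rw [havg, ← hfact]
    simpa using Finset.sum_le_sum fun σ (_ : σ ∈ Finset.univ) => hle σ
  rw [mul_div_assoc', le_div_iff₀ hKpos] at hfin
  nlinarith

-- Given `A`, the observation has law `N(Ax, I)`, and Fubini's theorem averages over `A`. The
-- measurability allows exchanging this average with the sum over permutations.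
set_option maxHeartbeats 400000 in
theorem prod_success_eq {m n : ℕ} (P : SamplingMatrix m n) (est : Estimator m n) (α : ℝ)
    (x : Fin n → ℝ) (k : ℕ) (hk : (sparsityPattern x).card = k) :
    Measurable (fun A => (Measure.pi fun r => gaussianReal ((A *ᵥ x) r) 1)
      {y | distortion (sparsityPattern x) (est.toFun y A k) ≤ α}) ∧
    ∫⁻ A, (Measure.pi fun r => gaussianReal ((A *ᵥ x) r) 1)
      {y | distortion (sparsityPattern x) (est.toFun y A k) ≤ α} ∂P.law
      = 1 - errorProb P est α x := by
  have := P.isProbabilityMeasure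
  subst hk
  set k := (sparsityPattern x).card with hk
  have hmap : Measurable fun p : Matrix (Fin m) (Fin n) ℝ × (Fin m → ℝ) =>
      (p.1 *ᵥ x + p.2, p.1) := by
    refine Measurable.prodMk ?_ measurable_fst
    refine measurable_pi_lambda _ fun r => ?_
    simp only [Pi.add_apply, Matrix.mulVec, dotProduct]
    refine (Finset.measurable_sum _ fun i _ => ?_).add ((measurable_pi_apply r).comp measurable_snd)
    exact ((measurable_pi_apply i).comp ((measurable_pi_apply (X := fun _ : Fin m => Fin n → ℝ) r).comp measurable_fst)).mul_const _
  set Sc : Set (Matrix (Fin m) (Fin n) ℝ × (Fin m → ℝ)) :=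
    {p | distortion (sparsityPattern x) (est.toFun (p.1 *ᵥ x + p.2) p.1 k) ≤ α} with hSc
  have hScm : MeasurableSet Sc := by
    have h' := hmap (measurableSet_distortion_le est k (sparsityPattern x) α)
    simpa only [Set.preimage_ofPred_eq] using h'
  have hcompl : {p : Matrix (Fin m) (Fin n) ℝ × (Fin m → ℝ) | α < distortion (sparsityPattern x)
      (est.toFun (p.1 *ᵥ x + p.2) p.1 k)} = Scᶜ := by
    ext p
    simp [hSc]
  have hsec : ∀ A, (Measure.pi fun r => gaussianReal ((A *ᵥ x) r) 1)
      {y | distortion (sparsityPattern x) (est.toFun y A k) ≤ α}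
      = (Measure.pi fun _ : Fin m => gaussianReal 0 1) (Prod.mk A ⁻¹' Sc) := by
    intro A
    have h1 : (fun r => gaussianReal ((A *ᵥ x) r) 1)
        = fun r => (gaussianReal 0 1).map ((A *ᵥ x) r + ·) := by
      funext r
      rw [gaussianReal_map_const_add, zero_add]
    have : ∀ r, IsProbabilityMeasure ((gaussianReal 0 1).map ((A *ᵥ x) r + ·)) := fun r =>
      Measure.isProbabilityMeasure_map (by fun_prop)
    rw [h1, ← Measure.pi_map_pi (fun r => by fun_prop), Measure.map_apply (by fun_prop)]
    · rfl
    · exact measurableSet_section_distortion_le est k _ α A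
  simp_rw [hsec]
  refine ⟨measurable_measure_prodMk_left hScm, ?_⟩
  rw [← Measure.prod_apply hScm, errorProb, hcompl, prob_compl_eq_one_sub hScm,
    ENNReal.sub_sub_cancel ENNReal.one_ne_top prob_le_one]

set_option maxHeartbeats 400000 in
/-- The nonasymptotic converse: `T` is the set of nonzero entries revealed to the decoder, and
`K` is the number of remaining sparsity patterns per estimate. -/
theorem log_mul_one_sub_le {m n b : ℕ} (hn : 2 ≤ n) (P : SamplingMatrix m n)
    (est : Estimator m n) {x : Fin n → ℝ} {T : Finset (Fin n)}
    (hT : T ⊆ sparsityPattern x) (hb : T.card + b = (sparsityPattern x).card)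
    (hpos : 0 < (sparsityPattern x).card) {α K ε : ℝ} (hK1 : 1 ≤ K) (hε0 : 0 ≤ ε) (hε1 : ε ≤ 1)
    (hK : ∀ (U : Finset {i // i ∉ T}) (a : ℕ), U.card = b + a →
      K * ((Finset.powersetCard b Finset.univ).filter fun t : Finset {i // i ∉ T} =>
        ((a + (t \ U).card : ℕ) : ℝ) ≤ α * (sparsityPattern x).card).card
        ≤ (Fintype.card {i // i ∉ T}).choose b)
    (herr : ∀ σ : Equiv.Perm (Fin n), errorProb P est α (x ∘ σ) ≤ ENNReal.ofReal ε)
    {w : ℝ} (hw0 : 0 ≤ w)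
    (hw : ∑ i ∈ Tᶜ, x i ^ 2 - (∑ i ∈ Tᶜ, x i) ^ 2 / n ≤ w * ((n : ℝ) - 1)) :
    Real.log K * (1 - ε) ≤ 1 + m / 2 * Real.log (1 + w) := by
  have := P.isProbabilityMeasure
  have hn' : (2 : ℝ) ≤ n := by exact_mod_cast hn
  set k := (sparsityPattern x).card with hk
  -- The mean over all `n` coordinates of the unrevealed part. Moving it into `g` makes `z` sum to
  -- zero and replaces a second moment by a variance.
  set c : ℝ := (∑ i ∈ Tᶜ, x i) / n with hc
  set z : Fin n → ℝ := fun i => (if i ∈ T then 0 else x i) - c with hz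
  set g : Fin n → ℝ := fun i => (if i ∈ T then x i else 0) + c with hg
  have hgz : ∀ i, x i - g i = z i := fun i => by
    simp only [hz, hg]
    split_ifs <;> ring
  have hsumT : ∀ f : Fin n → ℝ, ∑ i, (if i ∈ T then 0 else f i) = ∑ i ∈ Tᶜ, f i := fun f => by
    rw [← Finset.sum_filter_add_sum_filter_not _ (· ∈ T), Finset.sum_eq_zero, zero_add]
    · refine Finset.sum_congr (by ext; simp) fun i hi => ?_
      simp only [Finset.mem_compl] at hi
      simp [hi]
    · intro i hi
      simp only [Finset.mem_filter] at hi
      simp [hi.2]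
  have hzsum : ∑ i, z i = 0 := by
    simp only [hz, Finset.sum_sub_distrib, hsumT, Finset.sum_const, Finset.card_fin, nsmul_eq_mul,
      hc]
    field_simp
    ring
  have hzsq : ∑ i, z i ^ 2 = ∑ i ∈ Tᶜ, x i ^ 2 - (∑ i ∈ Tᶜ, x i) ^ 2 / n := by
    have : ∀ i, z i ^ 2 = (if i ∈ T then 0 else x i ^ 2) - 2 * c * (if i ∈ T then 0 else x i)
        + c ^ 2 := fun i => by
      simp only [hz]
      split_ifs <;> ring
    simp only [this, Finset.sum_add_distrib, Finset.sum_sub_distrib, ← Finset.mul_sum, hsumT,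
      Finset.sum_const, Finset.card_fin, nsmul_eq_mul, hc]
    field_simp
    ring
  have hzw : (∑ i, z i ^ 2) / ((n : ℝ) - 1) ≤ w := by
    rw [div_le_iff₀ (by linarith), hzsq]
    exact hw
  -- The reference variance matches the noise variance plus the average signal power per sample.
  set v : ℝ≥0 := 1 + w.toNNReal with hv
  have hv1 : 1 ≤ v := by simp [hv]
  have hvw : (v : ℝ) = 1 + w := by simp [hv, hw0]
  have hvpos : (0 : ℝ) < v := by rw [hvw]; linarith
  have hlogv : 0 ≤ Real.log v := Real.log_nonneg (by exact_mod_cast hv1)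
  have hlogK : 0 ≤ Real.log K := Real.log_nonneg hK1
  set N : ℝ := (Nat.factorial n : ℝ) with hN
  have hNpos : 0 < N := by rw [hN]; exact_mod_cast Nat.factorial_pos n
  have hcardN : (Fintype.card (Equiv.Perm (Fin n)) : ℝ) = N := by
    rw [Fintype.card_perm, Fintype.card_fin]
  set μ : Matrix (Fin m) (Fin n) ℝ → Equiv.Perm (Fin n) → Measure (Fin m → ℝ) := fun A σ =>
    Measure.pi fun r => gaussianReal ((A *ᵥ (x ∘ σ)) r) 1 with hμ
  set S : Matrix (Fin m) (Fin n) ℝ → Equiv.Perm (Fin n) → Set (Fin m → ℝ) := fun A σ =>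
    {y | distortion (sparsityPattern (x ∘ σ)) (est.toFun y A k) ≤ α} with hS
  have hA : ∀ A, Real.log K * ∑ σ, (μ A σ).real (S A σ) + N * (m / 2)
      ≤ N * (1 + m / 2 * Real.log v + m / (2 * v)) + N * (w / (2 * v)) * (A * Aᵀ).trace := by
    intro A
    have h1 : ∀ σ : Equiv.Perm (Fin n), Real.log K * (μ A σ).real (S A σ) + m / 2
        ≤ K * (Measure.pi fun r => gaussianReal ((A *ᵥ (g ∘ σ)) r) v).real (S A σ)
          + m / 2 * Real.log v + (m + ∑ r, (A *ᵥ (z ∘ σ)) r ^ 2) / (2 * v) := by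
      intro σ
      have h := log_mul_measureReal_pi_gaussianReal_le (A *ᵥ (x ∘ σ)) (A *ᵥ (g ∘ σ)) hv1 hK1
        (S := S A σ) (measurableSet_section_distortion_le est k _ α A)
      have hd : ∀ r, (A *ᵥ (x ∘ σ)) r - (A *ᵥ (g ∘ σ)) r = (A *ᵥ (z ∘ σ)) r := fun r => by
        rw [← Pi.sub_apply, ← Matrix.mulVec_sub]
        have : x ∘ σ - g ∘ σ = z ∘ σ := funext fun i => hgz (σ i)
        rw [this]
      simpa only [hd] using h
    have h2 := Finset.sum_le_sum fun σ (_ : σ ∈ Finset.univ) => h1 σ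
    simp only [Finset.sum_add_distrib, ← Finset.mul_sum, ← Finset.sum_div, Finset.sum_const,
      Finset.card_univ, nsmul_eq_mul, hcardN] at h2
    -- The factor `K` of the change of measure cancels the `1/K` of blind guessing; this leaves the
    -- additive `1` of the conclusion.
    have h3 := sum_measureReal_success_le est A hT hb hpos (g := g)
      (fun i j hi hj => by simp [hg, hi, hj]) (by linarith) hK v
    have htr : 0 ≤ (A * Aᵀ).trace := by
      simp only [Matrix.trace, Matrix.diag_apply, Matrix.mul_apply, Matrix.transpose_apply]
      exact Finset.sum_nonneg fun _ _ => Finset.sum_nonneg fun _ _ => mul_self_nonneg _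
    have h4 : ∑ σ : Equiv.Perm (Fin n), ∑ r, (A *ᵥ (z ∘ σ)) r ^ 2
        ≤ N * (w * (A * Aᵀ).trace) :=
      (sum_mulVec_sq_le hn z hzsum A).trans (by gcongr)
    have h5 : (N * m + ∑ σ : Equiv.Perm (Fin n), ∑ r, (A *ᵥ (z ∘ σ)) r ^ 2) / (2 * v)
        ≤ (N * m + N * (w * (A * Aᵀ).trace)) / (2 * v) := by gcongr
    have h6 : (N * m + N * (w * (A * Aᵀ).trace)) / (2 * v)
        = N * (m / (2 * v)) + N * (w / (2 * v)) * (A * Aᵀ).trace := by ring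
    rw [h6] at h5
    simp only [μ, S] at h3 ⊢
    linarith
  have hA' : ∀ A, ENNReal.ofReal (Real.log K) * ∑ σ, μ A σ (S A σ) + ENNReal.ofReal (N * (m / 2))
      ≤ ENNReal.ofReal (N * (1 + m / 2 * Real.log v + m / (2 * v)))
        + ENNReal.ofReal (N * (w / (2 * v))) * ENNReal.ofReal (A * Aᵀ).trace := by
    intro A
    have htr : 0 ≤ (A * Aᵀ).trace := by
      simp only [Matrix.trace, Matrix.diag_apply, Matrix.mul_apply, Matrix.transpose_apply]
      exact Finset.sum_nonneg fun _ _ => Finset.sum_nonneg fun _ _ => mul_self_nonneg _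
    have h1 : ∑ σ, μ A σ (S A σ) = ENNReal.ofReal (∑ σ, (μ A σ).real (S A σ)) := by
      rw [ENNReal.ofReal_sum_of_nonneg fun _ _ => measureReal_nonneg]
      exact Finset.sum_congr rfl fun σ _ => (ofReal_measureReal (measure_ne_top _ _)).symm
    have h2 : 0 ≤ ∑ σ, (μ A σ).real (S A σ) := Finset.sum_nonneg fun _ _ => measureReal_nonneg
    rw [h1, ← ENNReal.ofReal_mul hlogK, ← ENNReal.ofReal_mul (by positivity),
      ← ENNReal.ofReal_add (by positivity) (by positivity),
      ← ENNReal.ofReal_add (by positivity) (by positivity)]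
    exact ENNReal.ofReal_le_ofReal (hA A)
  have hint := lintegral_mono (μ := P.law) hA'
  have hprod := fun σ : Equiv.Perm (Fin n) =>
    prod_success_eq P est α (x ∘ σ) k (card_sparsityPattern_comp x σ)
  rw [lintegral_add_right _ measurable_const, lintegral_add_left measurable_const, lintegral_const,
    lintegral_const, measure_univ, mul_one, mul_one,
    lintegral_const_mul' _ _ ENNReal.ofReal_ne_top,
    lintegral_const_mul' _ _ ENNReal.ofReal_ne_top, P.normalized,
    lintegral_finsetSum _ fun σ _ => (hprod σ).1,
    Finset.sum_congr rfl fun σ _ => (hprod σ).2] at hint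
  have hlow : ENNReal.ofReal (N * (1 - ε))
      ≤ ∑ σ : Equiv.Perm (Fin n), (1 - errorProb P est α (x ∘ σ)) := by
    rw [← hcardN, ENNReal.ofReal_mul (by positivity), ENNReal.ofReal_natCast, ← Finset.card_univ,
      ← nsmul_eq_mul]
    refine Finset.card_nsmul_le_sum _ _ _ fun σ _ => ?_
    rw [ENNReal.ofReal_sub _ hε0, ENNReal.ofReal_one]
    exact tsub_le_tsub_left (herr σ) _
  have hfin := (add_le_add_left (mul_le_mul_right hlow _) _).trans hint
  rw [← ENNReal.ofReal_natCast, ← ENNReal.ofReal_mul hlogK, ← ENNReal.ofReal_mul (by positivity),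
    ← ENNReal.ofReal_add (mul_nonneg hlogK (mul_nonneg hNpos.le (by linarith))) (by positivity),
    ← ENNReal.ofReal_add (by positivity) (by positivity),
    ENNReal.ofReal_le_ofReal_iff (by positivity)] at hfin
  have hfin' : N * (Real.log K * (1 - ε) + m / 2)
      ≤ N * (1 + m / 2 * Real.log v + (m / (2 * v) + w / (2 * v) * m)) := by linarith
  have h7 := le_of_mul_le_mul_left hfin' hNpos
  -- For `v = 1 + w` the quadratic terms cancel the `m / 2` on the left, and only the logarithm
  -- survives.
  have h8 : (m / (2 * v) + w / (2 * v) * m : ℝ) = m / 2 := by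
    rw [hvw] at hvpos ⊢
    field_simp
  rw [h8, hvw] at h7
  linarith

/-! ### Counting sparsity patterns. -/

/-- An exponential-weight bound for the number of sets close to a given one. -/
theorem card_filter_mul_le {ι : Type*} [Fintype ι] [DecidableEq ι] (U : Finset ι) {a b : ℕ}
    (hU : U.card = b + a) (r : ℝ) {l μ : ℝ} (hl0 : 0 < l) (hl1 : l ≤ 1) (hμ : 0 < μ) :
    (((Finset.powersetCard b Finset.univ).filter fun t : Finset ι =>
        ((a + (t \ U).card : ℕ) : ℝ) ≤ r).card : ℝ) * (μ ^ b * l ^ r)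
      ≤ (1 + μ) ^ b * (1 + l * μ) ^ (Fintype.card ι - b) := by
  -- The total of the product weights over all sets factorizes, and each counted set has weight at
  -- least `μ ^ b * l ^ (r - a)`.
  set f : ι → ℝ := fun i => if i ∈ U then μ else l * μ with hf
  have hprod : ∀ t : Finset ι, ∏ i ∈ t, f i = μ ^ t.card * l ^ (t \ U).card := by
    intro t
    have h1 : ∀ i, f i = μ * if i ∈ U then 1 else l := fun i => by
      simp only [hf]
      split_ifs <;> ring
    simp only [h1, Finset.prod_mul_distrib, Finset.prod_const]
    rw [Finset.prod_ite, Finset.prod_const_one, Finset.prod_const, one_mul, Finset.sdiff_eq_filter]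
  have hall : ∑ t : Finset ι, ∏ i ∈ t, f i
      = (1 + μ) ^ (b + a) * (1 + l * μ) ^ (Fintype.card ι - (b + a)) := by
    rw [← Finset.powerset_univ, ← Finset.prod_one_add]
    have h1 : ∀ i, 1 + f i = if i ∈ U then 1 + μ else 1 + l * μ := fun i => by
      simp only [hf]
      split_ifs <;> rfl
    simp only [h1]
    rw [Finset.prod_ite, Finset.prod_const, Finset.prod_const, Finset.filter_mem_eq_inter,
      Finset.univ_inter, hU, ← Finset.compl_filter, Finset.filter_mem_eq_inter, Finset.univ_inter,
      Finset.card_compl, hU]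
  have hle : (((Finset.powersetCard b Finset.univ).filter fun t : Finset ι =>
        ((a + (t \ U).card : ℕ) : ℝ) ≤ r).card : ℝ) * (μ ^ b * (l ^ r / l ^ a))
      ≤ ∑ t : Finset ι, ∏ i ∈ t, f i := by
    rw [← nsmul_eq_mul]
    refine (Finset.card_nsmul_le_sum _ (fun t => ∏ i ∈ t, f i) _ fun t ht => ?_).trans
      (Finset.sum_le_univ_sum_of_nonneg fun t => ?_)
    · rw [Finset.mem_filter, Finset.mem_powersetCard] at ht
      rw [hprod, ht.1.2]
      refine mul_le_mul_of_nonneg_left ?_ (by positivity)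
      rw [div_le_iff₀ (by positivity), ← pow_add, ← Real.rpow_natCast, add_comm]
      exact Real.rpow_le_rpow_of_exponent_ge hl0 hl1 ht.2
    · rw [hprod]
      positivity
  rw [hall] at hle
  have hba : b + a ≤ Fintype.card ι := hU ▸ Finset.card_le_univ U
  have hexp : Fintype.card ι - b = a + (Fintype.card ι - (b + a)) := by lia
  -- As `l ≤ 1`, the bound for `a = 0` is the worst one, which removes the dependence on `a`.
  have hl : l ^ a * (1 + μ) ^ a ≤ (1 + l * μ) ^ a := by
    rw [← mul_pow]
    refine pow_le_pow_left₀ (by positivity) ?_ _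
    linarith
  have h2 := mul_le_mul_of_nonneg_left hle (pow_nonneg hl0.le a)
  calc _ = l ^ a * ((((Finset.powersetCard b Finset.univ).filter fun t : Finset ι =>
        ((a + (t \ U).card : ℕ) : ℝ) ≤ r).card : ℝ) * (μ ^ b * (l ^ r / l ^ a))) := by
        field_simp
    _ ≤ _ := h2
    _ = (1 + μ) ^ b * (1 + l * μ) ^ (Fintype.card ι - (b + a)) * (l ^ a * (1 + μ) ^ a) := by
        rw [pow_add]
        ring
    _ ≤ (1 + μ) ^ b * (1 + l * μ) ^ (Fintype.card ι - (b + a)) * (1 + l * μ) ^ a :=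
        mul_le_mul_of_nonneg_left hl (by positivity)
    _ = _ := by
        rw [hexp, pow_add]
        ring

/-- Serves the case `α = 0`, where the optimal tilt degenerates to `l = 0`. -/
theorem card_filter_le_one {ι : Type*} [Fintype ι] [DecidableEq ι] (U : Finset ι) {a b : ℕ}
    (hU : U.card = b + a) {r : ℝ} (hr : r = 0) :
    ((Finset.powersetCard b Finset.univ).filter fun t : Finset ι =>
        ((a + (t \ U).card : ℕ) : ℝ) ≤ r).card ≤ 1 := by
  subst hr
  rw [Finset.card_le_one_iff_subset_singleton]
  refine ⟨U, fun t ht => ?_⟩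
  rw [Finset.mem_filter, Finset.mem_powersetCard] at ht
  obtain ⟨⟨_, h1⟩, h2⟩ := ht
  have h3 : a + (t \ U).card = 0 := by
    have : a + (t \ U).card ≤ 0 := by exact_mod_cast h2
    lia
  have h4 : t \ U = ∅ := Finset.card_eq_zero.1 (by lia)
  rw [Finset.mem_singleton]
  exact Finset.eq_of_subset_of_card_le (Finset.sdiff_eq_empty_iff_subset.1 h4) (by lia)

theorem le_log_factorial (n : ℕ) : n * Real.log n - n ≤ Real.log n.factorial := by
  rcases eq_or_ne n 0 with rfl | hn
  · simp
  have h := Stirling.le_log_factorial_stirling hn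
  have h1 : 0 ≤ Real.log n := Real.log_natCast_nonneg n
  have h2 : 0 ≤ Real.log (2 * Real.pi) := Real.log_nonneg (by linarith [Real.pi_gt_three])
  linarith

/-- The Stirling sequence decreases from `e / √2`; the `√2` cancels against its normalization, which
leaves the constant `1`. -/
theorem log_factorial_le (n : ℕ) :
    Real.log n.factorial ≤ n * Real.log n - n + Real.log n / 2 + 1 := by
  rcases n with _ | n
  · simp
  have h1 := Stirling.log_stirlingSeq_formula (n + 1)
  have h2 : Real.log (Stirling.stirlingSeq (n + 1)) ≤ Real.log (Stirling.stirlingSeq 1) :=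
    Stirling.log_stirlingSeq'_antitone (Nat.zero_le n)
  have hpos : (0 : ℝ) < ((n + 1 : ℕ) : ℝ) := by positivity
  rw [Stirling.stirlingSeq_one, Real.log_div (Real.exp_ne_zero _) (by positivity), Real.log_exp,
    Real.log_sqrt (by norm_num)] at h2
  rw [Real.log_mul (by norm_num) hpos.ne', Real.log_div hpos.ne' (Real.exp_ne_zero _),
    Real.log_exp] at h1
  linarith

theorem le_log_choose (b j : ℕ) :
    ((b + j : ℕ) : ℝ) * Real.log (b + j : ℕ) - b * Real.log b - j * Real.log j
      - (Real.log b / 2 + Real.log j / 2 + 2) ≤ Real.log ((b + j).choose b) := by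
  have h := Nat.add_choose_mul_factorial_mul_factorial b j
  rw [← Nat.choose_symm_add] at h
  have h' : Real.log ((b + j).choose b) + Real.log b.factorial + Real.log j.factorial
      = Real.log (b + j).factorial := by
    rw [← h]
    push_cast
    have hc : (((b + j).choose b : ℕ) : ℝ) ≠ 0 := by
      exact_mod_cast (Nat.choose_pos (Nat.le_add_right b j)).ne'
    rw [Real.log_mul (mul_ne_zero hc (by positivity)) (by positivity),
      Real.log_mul hc (by positivity)]
  have h1 := le_log_factorial (b + j)
  have h2 := log_factorial_le b
  have h3 := log_factorial_le j
  push_cast at h1 ⊢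
  linarith

/-- The exponential growth rate of binomial coefficients. -/
theorem exists_tendsto_le_log_choose {b j : ℕ → ℕ} {B J : ℝ}
    (hb : Tendsto (fun n => (b n : ℝ) / n) atTop (𝓝 B))
    (hj : Tendsto (fun n => (j n : ℝ) / n) atTop (𝓝 J)) (hle : ∀ n, b n + j n ≤ n) :
    ∃ u : ℕ → ℝ, (∀ᶠ n in atTop, u n ≤ Real.log ((b n + j n).choose (b n)) / n) ∧
      Tendsto u atTop (𝓝 ((B + J) * Real.log (B + J) - B * Real.log B - J * Real.log J)) := by
  set f : ℝ → ℝ := fun x => x * Real.log x with hf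
  have hfc : Continuous f := Real.continuous_mul_log
  -- The subtracted terms dominate the Stirling corrections because `b, j ≤ n`. Continuity of `x log
  -- x` at `0` covers vanishing limits.
  refine ⟨fun n => f (b n / n + j n / n) - f (b n / n) - f (j n / n)
    - (Real.log n / n + 2 / n), ?_, ?_⟩
  · filter_upwards [eventually_gt_atTop 0] with n hn
    have hn' : (0 : ℝ) < n := by exact_mod_cast hn
    have hfn : ∀ x : ℕ, f (x / n) = (x * Real.log x - x * Real.log n) / n := by
      intro x
      rcases eq_or_ne x 0 with rfl | hx
      · simp [hf]
      · simp only [hf]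
        rw [Real.log_div (by exact_mod_cast hx) hn'.ne']
        ring
    have hlog : ∀ x : ℕ, x ≤ n → Real.log x ≤ Real.log n := by
      intro x hx
      rcases eq_or_ne x 0 with rfl | hx0
      · simpa using Real.log_natCast_nonneg n
      · exact Real.log_le_log (by positivity) (by exact_mod_cast hx)
    have h1 := le_log_choose (b n) (j n)
    have h2 := hlog (b n) (by have := hle n; lia)
    have h3 := hlog (j n) (by have := hle n; lia)
    have h4 := hfn (b n + j n)
    rw [Nat.cast_add, add_div] at h4
    rw [h4, hfn, hfn, ← add_div, ← sub_div, ← sub_div, ← sub_div]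
    gcongr
    push_cast at h1
    linarith
  · have hlog : Tendsto (fun n : ℕ => Real.log n / n) atTop (𝓝 0) := by
      have := Real.isLittleO_log_id_atTop.tendsto_div_nhds_zero
      exact this.comp tendsto_natCast_atTop_atTop
    have h2 : Tendsto (fun n : ℕ => (2 : ℝ) / n) atTop (𝓝 0) :=
      tendsto_const_div_atTop_nhds_zero_nat 2
    have := ((((hfc.tendsto _).comp (hb.add hj)).sub ((hfc.tendsto _).comp hb)).sub
      ((hfc.tendsto _).comp hj)).sub (hlog.add h2)
    simpa [hf] using this

/-! ### Quantiles and deterministic approximation of a distribution. -/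

/-- The quantile function of a distribution on the real line. -/
def quantile (G : Measure ℝ) (u : ℝ) : ℝ := sInf {t | u ≤ cdf G t}

/-- Right continuity of the distribution function makes the infimum attained; `0 < u < 1` makes the
set bounded below and nonempty. -/
theorem quantile_le_iff (G : Measure ℝ) {u : ℝ} (hu0 : 0 < u) (hu1 : u < 1) (t : ℝ) :
    quantile G u ≤ t ↔ u ≤ cdf G t := by
  have hne : ({t | u ≤ cdf G t} : Set ℝ).Nonempty :=
    ((tendsto_cdf_atTop G).eventually (eventually_ge_nhds hu1)).exists
  obtain ⟨s, hs⟩ := ((tendsto_cdf_atBot G).eventually (eventually_lt_nhds hu0)).exists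
  have hbdd : BddBelow {t | u ≤ cdf G t} := ⟨s, fun t ht => by
    by_contra! h
    exact absurd (monotone_cdf G h.le) (not_le.2 (hs.trans_le ht))⟩
  refine ⟨fun h => ?_, fun h => csInf_le hbdd h⟩
  have hright : Tendsto (cdf G) (𝓝[>] t) (𝓝 (cdf G t)) :=
    ((cdf G).right_continuous t).mono Set.Ioi_subset_Ici_self
  refine ge_of_tendsto hright ?_
  filter_upwards [self_mem_nhdsWithin] with r hr
  obtain ⟨t', ht', htr⟩ := exists_lt_of_csInf_lt hne (lt_of_le_of_lt h hr)
  exact ht'.trans (monotone_cdf G htr.le)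

theorem monotoneOn_quantile (G : Measure ℝ) : MonotoneOn (quantile G) (Set.Ioo 0 1) :=
  fun _ hu _ hu' h =>
    (quantile_le_iff G hu.1 hu.2 _).2 (h.trans ((quantile_le_iff G hu'.1 hu'.2 _).1 le_rfl))

theorem aemeasurable_quantile (G : Measure ℝ) :
    AEMeasurable (quantile G) (volume.restrict (Set.Ioo 0 1)) :=
  aemeasurable_restrict_of_monotoneOn measurableSet_Ioo (monotoneOn_quantile G)

theorem map_quantile (G : Measure ℝ) [IsProbabilityMeasure G] :
    (volume.restrict (Set.Ioo (0 : ℝ) 1)).map (quantile G) = G := by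
  refine Measure.ext_of_Iic _ _ fun t => ?_
  rw [Measure.map_apply_of_aemeasurable (aemeasurable_quantile G) measurableSet_Iic,
    Measure.restrict_apply₀' measurableSet_Ioo.nullMeasurableSet, ← ofReal_cdf]
  have hset : quantile G ⁻¹' Set.Iic t ∩ Set.Ioo 0 1 = Set.Iic (cdf G t) ∩ Set.Ioo 0 1 := by
    ext u
    simp only [Set.mem_inter_iff, Set.mem_preimage, Set.mem_Iic, and_congr_left_iff]
    exact fun hu => quantile_le_iff G hu.1 hu.2 t
  rw [hset]
  refine le_antisymm ?_ ?_
  · refine (measure_mono (t := Set.Ioc 0 (cdf G t)) fun u hu => ⟨hu.2.1, hu.1⟩).trans ?_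
    rw [Real.volume_Ioc, sub_zero]
  · refine le_trans ?_ (measure_mono (s := Set.Ioo 0 (cdf G t)) fun u hu =>
      ⟨hu.2.le, hu.1, hu.2.trans_le (cdf_le_one G t)⟩)
    rw [Real.volume_Ioo, sub_zero]

theorem intervalIntegrable_comp_quantile (G : Measure ℝ) [IsProbabilityMeasure G] {f : ℝ → ℝ}
    (hf : Integrable f G) :
    IntervalIntegrable (fun u => f (quantile G u)) volume 0 1 ∧
      ∫ u in (0 : ℝ)..1, f (quantile G u) = ∫ x, f x ∂G := by
  have hf' := hf
  rw [← map_quantile G] at hf'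
  have hm := aemeasurable_quantile G
  refine ⟨?_, ?_⟩
  · rw [intervalIntegrable_iff_integrableOn_Ioo_of_le zero_le_one]
    exact (integrable_map_measure hf'.aestronglyMeasurable hm).1 hf'
  · rw [intervalIntegral.integral_of_le zero_le_one, integral_Ioc_eq_integral_Ioo]
    conv_rhs => rw [← map_quantile G]
    rw [integral_map hm hf'.aestronglyMeasurable]

theorem card_fin_val_lt {k q : ℕ} (hq : q ≤ k) :
    (Finset.univ.filter fun i : Fin k => i.val < q).card = q := by
  rw [Fin.card_filter_val_lt]
  exact min_eq_right hq

/-- Block averages of the quantile function: a vector of length `k` whose empirical distribution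
approximates `G`, with the mean of `G` and no larger second moment. -/
theorem exists_vector_approx (G : Measure ℝ) [IsProbabilityMeasure G] (hG : MemLp id 2 G)
    (k : ℕ) :
    ∃ x : Fin k → ℝ,
      (∀ t, |((Finset.univ.filter fun i => x i ≤ t).card : ℝ) - k * cdf G t| ≤ 1) ∧
      ∑ i, x i = k * ∫ x, x ∂G ∧ ∑ i, x i ^ 2 ≤ k * ∫ x, x ^ 2 ∂G := by
  rcases Nat.eq_zero_or_pos k with rfl | hk
  · exact ⟨0, by simp⟩
  have hk' : (0 : ℝ) < k := by exact_mod_cast hk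
  obtain ⟨hi1, he1⟩ := intervalIntegrable_comp_quantile G (f := fun x => x)
    (hG.integrable one_le_two)
  obtain ⟨hi2, he2⟩ := intervalIntegrable_comp_quantile G (f := fun x => x ^ 2) hG.integrable_sq
  set p : ℕ → ℝ := fun i => i / k with hp
  have hp0 : p 0 = 0 := by simp [hp]
  have hpk : p k = 1 := by simp [hp, hk'.ne']
  have hpm : Monotone p := fun i j h => by
    simp only [hp]
    gcongr
  have hlt : ∀ i, p i < p (i + 1) := fun i => by
    simp only [hp]
    gcongr
    simp
  have hlen : ∀ i, p (i + 1) - p i = (k : ℝ)⁻¹ := fun i => by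
    simp only [hp]
    push_cast
    ring
  have hsub : ∀ i, i < k → Set.uIcc (p i) (p (i + 1)) ⊆ Set.uIcc 0 1 := fun i hi => by
    rw [Set.uIcc_of_le (hlt i).le, Set.uIcc_of_le zero_le_one, ← hp0, ← hpk]
    exact Set.Icc_subset_Icc (hpm (Nat.zero_le _)) (hpm hi)
  have hI1 : ∀ i, i < k → IntervalIntegrable (quantile G) volume (p i) (p (i + 1)) :=
    fun i hi => hi1.mono_set (hsub i hi)
  have hI2 : ∀ i, i < k → IntervalIntegrable (fun u => quantile G u ^ 2) volume (p i) (p (i + 1)) :=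
    fun i hi => hi2.mono_set (hsub i hi)
  have hIoo : ∀ i, i < k → ∀ u ∈ Set.Ioo (p i) (p (i + 1)), 0 < u ∧ u < 1 := fun i hi u hu =>
    ⟨lt_of_le_of_lt (hp0 ▸ hpm (Nat.zero_le i)) hu.1, lt_of_lt_of_le hu.2 (hpk ▸ hpm hi)⟩
  set a : ℕ → ℝ := fun i => k * ∫ u in p i..p (i + 1), quantile G u with ha
  have haI : ∀ i, ∫ u in p i..p (i + 1), quantile G u = a i / k := fun i => by
    simp only [ha]
    field_simp
  refine ⟨fun i => a i, fun t => ?_, ?_, ?_⟩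
  · have hc0 := cdf_nonneg G t
    have hc1 := cdf_le_one G t
    -- The quantile function exceeds `t` beyond `cdf G t` and is at most `t` before it. Only the
    -- block containing `cdf G t` is undecided, so the count lies between the floor and the ceiling
    -- of `k * cdf G t`.
    have hup : ∀ i : Fin k, a i ≤ t → ((i : ℕ) : ℝ) < k * cdf G t := by
      intro i hi
      by_contra! hcon
      have hpi : cdf G t ≤ p i := by
        simp only [hp]
        rw [le_div_iff₀ hk']
        linarith
      have hpos : 0 < ∫ u in p i..p (i + 1), (quantile G u - t) := by
        refine intervalIntegral.intervalIntegral_pos_of_pos_on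
          ((hI1 i i.2).sub intervalIntegrable_const) (fun u hu => ?_) (hlt i)
        obtain ⟨h0, h1⟩ := hIoo i i.2 u hu
        rw [sub_pos]
        by_contra! h
        exact absurd ((quantile_le_iff G h0 h1 t).1 h) (not_le.2 (hpi.trans_lt hu.1))
      rw [intervalIntegral.integral_sub (hI1 i i.2) intervalIntegrable_const,
        intervalIntegral.integral_const, hlen, haI, smul_eq_mul, ← div_eq_inv_mul, ← sub_div] at hpos
      have := (div_pos_iff_of_pos_right hk').1 hpos
      linarith
    have hdown : ∀ i : Fin k, ((i : ℕ) : ℝ) + 1 ≤ k * cdf G t → a i ≤ t := by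
      intro i hi
      have hpi : p (i + 1) ≤ cdf G t := by
        simp only [hp]
        rw [div_le_iff₀ hk']
        push_cast
        linarith
      have h := intervalIntegral.integral_mono_on_of_le_Ioo (hlt i).le (hI1 i i.2)
        (intervalIntegrable_const (c := t)) fun u hu => by
          obtain ⟨h0, h1⟩ := hIoo i i.2 u hu
          exact (quantile_le_iff G h0 h1 t).2 (hu.2.le.trans hpi)
      rw [intervalIntegral.integral_const, hlen, haI, smul_eq_mul, ← div_eq_inv_mul] at h
      exact (div_le_div_iff_of_pos_right hk').1 h
    have hfl : ⌊(k : ℝ) * cdf G t⌋₊ ≤ k := by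
      refine Nat.floor_le_of_le ?_
      nlinarith
    have hce : ⌈(k : ℝ) * cdf G t⌉₊ ≤ k := by
      refine Nat.ceil_le.2 ?_
      nlinarith
    have h1 : (Finset.univ.filter fun i : Fin k => a i ≤ t).card ≤ ⌈(k : ℝ) * cdf G t⌉₊ := by
      rw [← card_fin_val_lt hce]
      refine Finset.card_le_card (Finset.monotone_filter_right _ fun i _ hi => ?_)
      exact Nat.lt_ceil.2 (hup i hi)
    have h2 : ⌊(k : ℝ) * cdf G t⌋₊ ≤ (Finset.univ.filter fun i : Fin k => a i ≤ t).card := by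
      rw [← card_fin_val_lt hfl]
      refine Finset.card_le_card (Finset.monotone_filter_right _ fun i _ hi => ?_)
      refine hdown i ?_
      have := (Nat.le_floor_iff (by positivity)).1 (Nat.succ_le_of_lt hi)
      exact_mod_cast this
    have h1' : ((Finset.univ.filter fun i : Fin k => a i ≤ t).card : ℝ) ≤ ⌈(k : ℝ) * cdf G t⌉₊ := by
      exact_mod_cast h1
    have h2' : (⌊(k : ℝ) * cdf G t⌋₊ : ℝ) ≤ (Finset.univ.filter fun i : Fin k => a i ≤ t).card := by
      exact_mod_cast h2
    have h3 := Nat.ceil_lt_add_one (show 0 ≤ (k : ℝ) * cdf G t by positivity)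
    have h4 := Nat.lt_floor_add_one ((k : ℝ) * cdf G t)
    rw [abs_le]
    constructor <;> linarith
  · rw [Fin.sum_univ_eq_sum_range (fun i => a i) k, ← he1]
    simp only [ha]
    rw [← Finset.mul_sum, intervalIntegral.sum_integral_adjacent_intervals hI1, hp0, hpk]
  · rw [Fin.sum_univ_eq_sum_range (fun i => a i ^ 2) k, ← he2]
    have hsum := intervalIntegral.sum_integral_adjacent_intervals hI2
    rw [hp0, hpk] at hsum
    rw [← hsum, Finset.mul_sum]
    refine Finset.sum_le_sum fun i hi => ?_
    rw [Finset.mem_range] at hi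
    -- Jensen's inequality on a block, as nonnegativity of the variance.
    have h0 : 0 ≤ ∫ u in p i..p (i + 1), (quantile G u - a i) ^ 2 :=
      intervalIntegral.integral_nonneg (hlt i).le fun _ _ => sq_nonneg _
    have hexp : ∀ u, (quantile G u - a i) ^ 2
        = quantile G u ^ 2 - 2 * a i * quantile G u + a i ^ 2 := fun u => by ring
    simp only [hexp] at h0
    rw [intervalIntegral.integral_add ((hI2 i hi).sub ((hI1 i hi).const_mul _))
      intervalIntegrable_const, intervalIntegral.integral_sub (hI2 i hi) ((hI1 i hi).const_mul _),
      intervalIntegral.integral_const_mul, intervalIntegral.integral_const, hlen, haI,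
      smul_eq_mul] at h0
    have h1 := mul_nonneg hk'.le h0
    have h2 : (k : ℝ) * ((∫ u in p i..p (i + 1), quantile G u ^ 2) - 2 * a i * (a i / k)
        + (k : ℝ)⁻¹ * a i ^ 2) = k * (∫ u in p i..p (i + 1), quantile G u ^ 2) - a i ^ 2 := by
      field_simp
      ring
    linarith

/-- A zero among the block averages would spoil the sparsity. As `G` has no atom at `0` there are at
most two, and replacing them by `1/k` changes the counts and moments by at most `2`. -/
theorem exists_nonzero_vector_approx (G : Measure ℝ) [IsProbabilityMeasure G] (hG : MemLp id 2 G)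
    (hG0 : G {0} = 0) (k : ℕ) :
    ∃ y : Fin k → ℝ, (∀ i, y i ≠ 0) ∧
      (∀ t, |((Finset.univ.filter fun i => y i ≤ t).card : ℝ) - k * cdf G t| ≤ 3) ∧
      |∑ i, y i - k * ∫ x, x ∂G| ≤ 2 ∧ ∑ i, y i ^ 2 ≤ k * (∫ x, x ^ 2 ∂G) + 2 := by
  rcases Nat.eq_zero_or_pos k with rfl | hk
  · exact ⟨0, by simp⟩
  have hk1 : (1 : ℝ) ≤ k := by exact_mod_cast hk
  obtain ⟨x, hx1, hx2, hx3⟩ := exists_vector_approx G hG k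
  set Z := Finset.univ.filter fun i => x i = 0 with hZ
  have hleft : Tendsto (cdf G) (𝓝[<] 0) (𝓝 (cdf G 0)) := by
    have h1 := (monotone_cdf G).tendsto_leftLim 0
    have h2 := (cdf G).measure_singleton 0
    rw [measure_cdf, hG0, eq_comm, ENNReal.ofReal_eq_zero] at h2
    have h3 := (monotone_cdf G).leftLim_le (le_refl (0 : ℝ))
    rwa [le_antisymm h3 (by linarith)] at h1
  have hZ2 : (Z.card : ℝ) ≤ 2 := by
    -- One unit of counting error at `0` and one at `δ`; the remaining mass vanishes as `δ`
    -- increases to `0`.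
    have hδ : ∀ δ < 0, (Z.card : ℝ) ≤ 2 + (k * cdf G 0 - k * cdf G δ) := by
      intro δ hδ
      have h1 := (abs_le.1 (hx1 0)).2
      have h2 := (abs_le.1 (hx1 δ)).1
      have h3 : Z.card + (Finset.univ.filter fun i => x i ≤ δ).card
          ≤ (Finset.univ.filter fun i => x i ≤ 0).card := by
        rw [← Finset.card_union_of_disjoint]
        · refine Finset.card_le_card fun i hi => ?_
          simp only [hZ, Finset.mem_union, Finset.mem_filter, Finset.mem_univ, true_and] at hi ⊢
          rcases hi with hi | hi
          · exact hi.le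
          · exact hi.trans hδ.le
        · refine Finset.disjoint_filter.2 fun i _ h h' => ?_
          linarith
      have h3' : (Z.card : ℝ) + (Finset.univ.filter fun i => x i ≤ δ).card
          ≤ (Finset.univ.filter fun i => x i ≤ 0).card := by exact_mod_cast h3
      linarith
    have hlim : Tendsto (fun δ => 2 + (k * cdf G 0 - k * cdf G δ)) (𝓝[<] 0)
        (𝓝 (2 + (k * cdf G 0 - k * cdf G 0))) :=
      tendsto_const_nhds.add (tendsto_const_nhds.sub (tendsto_const_nhds.mul hleft))
    rw [sub_self, add_zero] at hlim
    refine ge_of_tendsto hlim ?_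
    filter_upwards [self_mem_nhdsWithin] with δ h
    exact hδ δ h
  set y : Fin k → ℝ := fun i => if x i = 0 then (k : ℝ)⁻¹ else x i with hy
  have hyne : ∀ i, x i ≠ 0 → y i = x i := fun i hi => if_neg hi
  have hyeq : ∀ i, x i = 0 → y i = (k : ℝ)⁻¹ := fun i hi => if_pos hi
  have hkinv : (k : ℝ)⁻¹ ≤ 1 := inv_le_one_of_one_le₀ hk1
  have hkpos : 0 < (k : ℝ)⁻¹ := by positivity
  have hsum : ∀ q : ℕ, q ≠ 0 → ∑ i, y i ^ q = ∑ i, x i ^ q + Z.card * (k : ℝ)⁻¹ ^ q := by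
    intro q hq
    have h1 : ∀ i, y i ^ q = x i ^ q + if x i = 0 then (k : ℝ)⁻¹ ^ q else 0 := fun i => by
      by_cases hi : x i = 0
      · rw [hyeq i hi, hi, if_pos rfl, zero_pow hq, zero_add]
      · rw [hyne i hi, if_neg hi, add_zero]
    simp only [h1, Finset.sum_add_distrib]
    rw [← Finset.sum_filter, Finset.sum_const, nsmul_eq_mul]
  refine ⟨y, fun i => ?_, fun t => ?_, ?_, ?_⟩
  · by_cases hi : x i = 0
    · rw [hyeq i hi]
      exact hkpos.ne'
    · rwa [hyne i hi]
  · have h1 : (Finset.univ.filter fun i => y i ≤ t).card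
        ≤ (Finset.univ.filter fun i => x i ≤ t).card + Z.card := by
      refine le_trans (Finset.card_le_card fun i hi => ?_) (Finset.card_union_le _ _)
      simp only [hZ, Finset.mem_union, Finset.mem_filter, Finset.mem_univ, true_and] at hi ⊢
      by_cases h : x i = 0
      · exact Or.inr h
      · exact Or.inl (hyne i h ▸ hi)
    have h2 : (Finset.univ.filter fun i => x i ≤ t).card
        ≤ (Finset.univ.filter fun i => y i ≤ t).card + Z.card := by
      refine le_trans (Finset.card_le_card fun i hi => ?_) (Finset.card_union_le _ _)
      simp only [hZ, Finset.mem_union, Finset.mem_filter, Finset.mem_univ, true_and] at hi ⊢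
      by_cases h : x i = 0
      · exact Or.inr h
      · exact Or.inl ((hyne i h).symm ▸ hi)
    have h1' : ((Finset.univ.filter fun i => y i ≤ t).card : ℝ)
        ≤ (Finset.univ.filter fun i => x i ≤ t).card + Z.card := by exact_mod_cast h1
    have h2' : ((Finset.univ.filter fun i => x i ≤ t).card : ℝ)
        ≤ (Finset.univ.filter fun i => y i ≤ t).card + Z.card := by exact_mod_cast h2
    have h3 := abs_le.1 (hx1 t)
    rw [abs_le]
    constructor <;> linarith [h3.1, h3.2]
  · have h := hsum 1 one_ne_zero
    simp only [pow_one] at h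
    rw [h, hx2, add_sub_cancel_left, abs_of_nonneg (by positivity)]
    nlinarith
  · rw [hsum 2 two_ne_zero]
    have : (Z.card : ℝ) * (k : ℝ)⁻¹ ^ 2 ≤ 2 * 1 := by
      gcongr
      exact pow_le_one₀ hkpos.le hkinv
    linarith

/-! ### Truncation and vectors of the source. -/

theorem normalize_measure {F ν : Measure ℝ} (hle : ν ≤ F)
    (hF : MemLp id 2 F) (hF0 : F {0} = 0) {c : ℝ} (hc : 0 < c)
    (hν : ν Set.univ = ENNReal.ofReal c) :
    IsProbabilityMeasure ((ν Set.univ)⁻¹ • ν) ∧ ((ν Set.univ)⁻¹ • ν) {0} = 0 ∧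
      MemLp id 2 ((ν Set.univ)⁻¹ • ν) ∧
      ∀ s, ν s = ENNReal.ofReal c * ((ν Set.univ)⁻¹ • ν) s := by
  have hc0 : ENNReal.ofReal c ≠ 0 := by simpa using hc
  have hinv : ENNReal.ofReal c * (ENNReal.ofReal c)⁻¹ = 1 :=
    ENNReal.mul_inv_cancel hc0 ENNReal.ofReal_ne_top
  rw [hν]
  refine ⟨⟨?_⟩, ?_, ?_, fun s => ?_⟩
  · rw [Measure.smul_apply, hν, smul_eq_mul, mul_comm, hinv]
  · rw [Measure.smul_apply, le_antisymm ((hle _).trans hF0.le) bot_le, smul_zero]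
  · exact (hF.mono_measure hle).smul_measure (ENNReal.inv_ne_top.2 hc0)
  · rw [Measure.smul_apply, smul_eq_mul, ← mul_assoc, hinv, one_mul]

theorem measurable_keepProb (F : Measure ℝ) (β : ℝ) : Measurable (keepProb F β) :=
  Measurable.ite (measurableSet_lt measurable_enorm measurable_const) measurable_const
    (Measurable.ite (measurableSet_eq_fun measurable_enorm measurable_const) measurable_const
      measurable_const)

theorem keepProb_le_one (F : Measure ℝ) (β x : ℝ) : keepProb F β x ≤ 1 := by
  rw [keepProb]
  split_ifs
  · exact le_rfl
  · exact tsub_le_self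
  · exact zero_le_one

/-- A distribution is the mixture of its truncation and a complementary distribution. -/
theorem exists_truncated_mixture (F : Measure ℝ) [IsProbabilityMeasure F] (hF : MemLp id 2 F)
    (hF0 : F {0} = 0) {β : ℝ} (hβ0 : 0 < β) (hβ1 : β ≤ 1) :
    (IsProbabilityMeasure (truncated F β) ∧ truncated F β {0} = 0 ∧
      MemLp id 2 (truncated F β)) ∧
    ∃ G : Measure ℝ, IsProbabilityMeasure G ∧ G {0} = 0 ∧ MemLp id 2 G ∧
      ∀ t, cdf F t = β * cdf (truncated F β) t + (1 - β) * cdf G t := by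
  set ν := F.withDensity fun x => 1 - keepProb F β x with hν
  have hsum : keptMeasure F β + ν = F := by
    rw [keptMeasure, hν, ← withDensity_add_left (measurable_keepProb F β)]
    have : (keepProb F β + fun x => 1 - keepProb F β x) = 1 := by
      funext x
      exact add_tsub_cancel_of_le (keepProb_le_one F β x)
    rw [this, withDensity_one]
  have hle1 : keptMeasure F β ≤ F := by
    conv_rhs => rw [← hsum]
    exact Measure.le_add_right le_rfl
  have hle2 : ν ≤ F := by
    conv_rhs => rw [← hsum]
    exact Measure.le_add_left le_rfl
  have hk := keptMeasure_univ F hβ1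
  have hνu : ν Set.univ = ENNReal.ofReal (1 - β) := by
    have h := congrArg (fun m : Measure ℝ => m Set.univ) hsum
    simp only [Measure.add_apply, hk, measure_univ] at h
    rw [ENNReal.ofReal_sub _ hβ0.le, ENNReal.ofReal_one, ← h,
      ENNReal.add_sub_cancel_left ENNReal.ofReal_ne_top]
  obtain ⟨hp, h0, hm, hs⟩ := normalize_measure hle1 hF hF0 hβ0 hk
  change IsProbabilityMeasure (truncated F β) at hp
  refine ⟨⟨hp, h0, hm⟩, ?_⟩
  have hF_Iic : ∀ t, F (Set.Iic t) = keptMeasure F β (Set.Iic t) + ν (Set.Iic t) := fun t => by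
    conv_lhs => rw [← hsum]
    rfl
  have key : ∀ G : Measure ℝ, IsProbabilityMeasure G →
      (∀ t, ν (Set.Iic t) = ENNReal.ofReal (1 - β) * G (Set.Iic t)) →
      ∀ t, cdf F t = β * cdf (truncated F β) t + (1 - β) * cdf G t := by
    intro G hG h t
    have h1 := hF_Iic t
    rw [h t, hs (Set.Iic t)] at h1
    change F (Set.Iic t) = ENNReal.ofReal β * truncated F β (Set.Iic t) + _ at h1
    have h2 := cdf_nonneg (truncated F β) t
    have h3 := cdf_nonneg G t
    have h4 : 0 ≤ 1 - β := by linarith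
    rw [← ofReal_cdf, ← ofReal_cdf, ← ofReal_cdf, ← ENNReal.ofReal_mul hβ0.le,
      ← ENNReal.ofReal_mul h4, ← ENNReal.ofReal_add (by positivity) (by positivity),
      ENNReal.ofReal_eq_ofReal_iff (cdf_nonneg F t) (by positivity)] at h1
    exact h1
  rcases hβ1.lt_or_eq with hβ | hβ
  · obtain ⟨hp', h0', hm', hs'⟩ := normalize_measure hle2 hF hF0 (sub_pos.2 hβ) hνu
    exact ⟨_, hp', h0', hm', key _ hp' fun t => hs' _⟩
  -- For `β = 1` the complementary measure is zero and cannot be normalized; its weight is zero, so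
  -- any law serves.
  · refine ⟨F, inferInstance, hF0, hF, key F inferInstance fun t => ?_⟩
    rw [hβ, sub_self, ENNReal.ofReal_zero] at hνu ⊢
    rw [zero_mul]
    exact le_antisymm ((measure_mono (Set.subset_univ _)).trans hνu.le) bot_le

/-- The layout is: unrevealed entries, then the revealed block `T`, then zeros. -/
theorem exists_concat {b t j n : ℕ} (hn : b + (t + j) = n) (y : Fin b → ℝ) (y' : Fin t → ℝ)
    (hy : ∀ i, y i ≠ 0) (hy' : ∀ i, y' i ≠ 0) :
    ∃ (x : Fin n → ℝ) (T : Finset (Fin n)), T ⊆ sparsityPattern x ∧ T.card = t ∧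
      (sparsityPattern x).card = b + t ∧ ∑ i ∈ Tᶜ, x i = ∑ i, y i ∧
      ∑ i ∈ Tᶜ, x i ^ 2 = ∑ i, y i ^ 2 ∧
      ∀ s, ((sparsityPattern x).filter fun i => x i ≤ s).card
        = (Finset.univ.filter fun i => y i ≤ s).card
          + (Finset.univ.filter fun i => y' i ≤ s).card := by
  subst hn
  set T : Finset (Fin (b + (t + j))) :=
    Finset.univ.filter fun i => b ≤ i.val ∧ i.val < b + t with hT
  set x : Fin (b + (t + j)) → ℝ := Fin.append y (Fin.append y' 0) with hx
  have hcompl : ∀ f : Fin (b + (t + j)) → ℝ,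
      ∑ i ∈ Tᶜ, f i = ∑ i, if b ≤ i.val ∧ i.val < b + t then 0 else f i := fun f => by
    rw [hT, Finset.compl_filter, Finset.sum_filter]
    exact Finset.sum_congr rfl fun i _ => by split_ifs <;> simp_all
  have hlt : ∀ i : Fin b, ¬ b ≤ i.val := fun i => not_le.2 i.2
  refine ⟨x, T, ?_, ?_, ?_, ?_, ?_, ?_⟩
  · intro i
    refine Fin.addCases (fun i => ?_) (fun i => Fin.addCases (fun i => ?_) (fun i => ?_) i) i
    · simp [hT]
    · simp [hT, sparsityPattern, hx, hy']
    · simp [hT]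
  · rw [hT, Finset.card_filter, Fin.sum_univ_add, Fin.sum_univ_add]
    simp
  · rw [sparsityPattern, Finset.card_filter, Fin.sum_univ_add, Fin.sum_univ_add]
    simp [hx, hy, hy']
  · rw [hcompl, Fin.sum_univ_add, Fin.sum_univ_add]
    simp [hx, hlt]
  · rw [hcompl, Fin.sum_univ_add, Fin.sum_univ_add]
    simp [hx, hlt]
  · intro s
    rw [sparsityPattern, Finset.filter_filter, Finset.card_filter, Fin.sum_univ_add,
      Fin.sum_univ_add, Finset.card_filter, Finset.card_filter]
    simp [hx, hy, hy']

/-- A vector with `k` nonzero entries, `⌊β k⌋` of which, those outside `T`, follow the truncated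
distribution. -/
theorem exists_source_vector (F : Measure ℝ) [IsProbabilityMeasure F] (hF : MemLp id 2 F)
    (hF0 : F {0} = 0) {β : ℝ} (hβ0 : 0 < β) (hβ1 : β ≤ 1) {k n : ℕ} (hkn : k ≤ n) :
    ∃ (x : Fin n → ℝ) (T : Finset (Fin n)), T ⊆ sparsityPattern x ∧
      (sparsityPattern x).card = k ∧ T.card + ⌊β * k⌋₊ = k ∧
      |∑ i ∈ Tᶜ, x i - ⌊β * k⌋₊ * ∫ x, x ∂truncated F β| ≤ 2 ∧
      ∑ i ∈ Tᶜ, x i ^ 2 ≤ ⌊β * k⌋₊ * (∫ x, x ^ 2 ∂truncated F β) + 2 ∧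
      ∀ s, |(((sparsityPattern x).filter fun i => x i ≤ s).card : ℝ) - k * cdf F s| ≤ 7 := by
  obtain ⟨⟨hp, h0, hm⟩, G, hGp, hG0, hGm, hcdf⟩ := exists_truncated_mixture F hF hF0 hβ0 hβ1
  set b := ⌊β * k⌋₊ with hb
  have hbk : b ≤ k := Nat.floor_le_of_le (mul_le_of_le_one_left (Nat.cast_nonneg k) hβ1)
  obtain ⟨y, hy0, hy1, hy2, hy3⟩ := exists_nonzero_vector_approx (truncated F β) hm h0 b
  obtain ⟨y', hy0', hy1', -, -⟩ := exists_nonzero_vector_approx G hGm hG0 (k - b)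
  obtain ⟨x, T, h1, h2, h3, h4, h5, h6⟩ :=
    exists_concat (b := b) (t := k - b) (j := n - k) (n := n) (by lia) y y' hy0 hy0'
  refine ⟨x, T, h1, by lia, by lia, by rw [h4]; exact hy2, by rw [h5]; exact hy3, fun s => ?_⟩
  have ha := abs_le.1 (hy1 s)
  have hc := abs_le.1 (hy1' s)
  rw [Nat.cast_sub hbk] at hc
  have hfl := Nat.floor_le (show 0 ≤ β * k by positivity)
  have hlt := Nat.lt_floor_add_one (β * k)
  rw [← hb] at hfl hlt
  -- Rounding `β k` to `b` costs at most `1`; with the two approximation errors of `3` this gives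
  -- `7`.
  have hd : |((b : ℝ) - β * k) * (cdf (truncated F β) s - cdf G s)| ≤ 1 := by
    rw [abs_mul]
    refine mul_le_one₀ (abs_le.2 ⟨by linarith, by linarith⟩) (abs_nonneg _) (abs_le.2 ⟨?_, ?_⟩)
    · linarith [cdf_nonneg (truncated F β) s, cdf_le_one G s]
    · linarith [cdf_le_one (truncated F β) s, cdf_nonneg G s]
  have hd' := abs_le.1 hd
  have hid : (k : ℝ) * cdf F s = b * cdf (truncated F β) s + (k - b) * cdf G s
      - ((b : ℝ) - β * k) * (cdf (truncated F β) s - cdf G s) := by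
    rw [hcdf]
    ring
  rw [h6, hid, abs_le]
  push_cast
  constructor <;> linarith [ha.1, ha.2, hc.1, hc.2, hd'.1, hd'.2]

/-! ### Passage to the limit. -/

theorem empiricalCDF_comp {n : ℕ} (x : Fin n → ℝ) (σ : Equiv.Perm (Fin n)) :
    empiricalCDF (x ∘ σ) = empiricalCDF x := by
  funext t
  rw [empiricalCDF, empiricalCDF, card_sparsityPattern_comp, ← sparsityPattern_comp x σ,
    Finset.filter_map, Finset.card_map, Finset.card_map]
  rfl

/-- A bounded counting error vanishes after division by `⌊Ωn⌋`. Arbitrary permutations at each `n`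
are needed to select the worst one later. -/
theorem comp_mem_source {Ω : ℝ} (hΩ : 0 < Ω) (F : Measure ℝ) {x : (n : ℕ) → Fin n → ℝ}
    (hcard : ∀ n : ℕ, (sparsityPattern (x n)).card = ⌊Ω * (n : ℝ)⌋₊) {C : ℝ}
    (happrox : ∀ n s, |(((sparsityPattern (x n)).filter fun i => x n i ≤ s).card : ℝ)
      - ⌊Ω * (n : ℝ)⌋₊ * cdf F s| ≤ C) (σ : (n : ℕ) → Equiv.Perm (Fin n)) :
    (fun n => x n ∘ σ n) ∈ source Ω F := by
  refine ⟨fun n => by rw [card_sparsityPattern_comp, hcard], ?_⟩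
  simp only [empiricalCDF_comp]
  have hk : Tendsto (fun n : ℕ => ((⌊Ω * (n : ℝ)⌋₊ : ℕ) : ℝ)) atTop atTop :=
    tendsto_natCast_atTop_atTop.comp
      (tendsto_nat_floor_atTop.comp (tendsto_natCast_atTop_atTop.const_mul_atTop hΩ))
  have hC := hk.const_div_atTop C
  rw [Metric.tendstoUniformly_iff]
  intro ε hε
  filter_upwards [hC.eventually (gt_mem_nhds hε), hk.eventually_gt_atTop 0] with n h1 h2 s
  rw [dist_comm, Real.dist_eq, empiricalCDF, hcard]
  refine lt_of_le_of_lt ?_ h1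
  rw [le_div_iff₀ h2]
  have h3 := happrox n s
  calc _ = |((((sparsityPattern (x n)).filter fun i => x n i ≤ s).card : ℝ)
        / (⌊Ω * (n : ℝ)⌋₊ : ℕ) - cdf F s) * (⌊Ω * (n : ℝ)⌋₊ : ℕ)| := by
        rw [abs_mul, abs_of_pos h2]
    _ = |(((sparsityPattern (x n)).filter fun i => x n i ≤ s).card : ℝ)
      - ⌊Ω * (n : ℝ)⌋₊ * cdf F s| := by
        congr 1
        field_simp
    _ ≤ C := h3

/-- The exponential growth rate of the number of sparsity patterns that are within distortion `α`
of an estimate, when all but a fraction `β` of the nonzero entries are known. -/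
theorem exists_pattern_count_bound {Ω α β : ℝ} (hΩ0 : 0 < Ω) (hΩ1 : Ω < 1) (hα : 0 ≤ α)
    (hβ0 : 0 < β) (hαβ : α < β) (hcond : α * Ω / (1 - Ω) ≤ 1 - α / β) {k b j : ℕ → ℕ}
    (hk : Tendsto (fun n => (k n : ℝ) / n) atTop (𝓝 Ω))
    (hb : Tendsto (fun n => (b n : ℝ) / n) atTop (𝓝 (β * Ω)))
    (hj : Tendsto (fun n => (j n : ℝ) / n) atTop (𝓝 (1 - Ω))) :
    ∃ L : ℕ → ℝ, (∀ n, 0 < L n) ∧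
      (∀ (n : ℕ) (ι : Type) [Fintype ι] [DecidableEq ι] (U : Finset ι) (a : ℕ),
        Fintype.card ι = b n + j n → U.card = b n + a →
        (((Finset.powersetCard (b n) Finset.univ).filter fun t : Finset ι =>
          ((a + (t \ U).card : ℕ) : ℝ) ≤ α * k n).card : ℝ) ≤ L n) ∧
      Tendsto (fun n => Real.log (L n) / n) atTop
        (𝓝 (β * Ω * Real.binEntropy (α / β)
          + (1 - Ω) * Real.binEntropy (α * Ω / (1 - Ω)))) := by
  rcases hα.eq_or_lt with rfl | hα
  · refine ⟨fun _ => 1, fun _ => one_pos, fun n ι _ _ U a _ hU => ?_, ?_⟩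
    · exact Nat.cast_le_one.2 (card_filter_le_one U hU (zero_mul (k n : ℝ)))
    · simp
  have hΩ' : 0 < 1 - Ω := by linarith
  set p := α / β with hp
  set q := α * Ω / (1 - Ω) with hq
  have hp0 : 0 < p := by positivity
  have hp1 : p < 1 := (div_lt_one hβ0).2 hαβ
  have hq0 : 0 < q := by positivity
  have hq1 : q < 1 := by linarith
  have hp' : 0 < 1 - p := by linarith
  have hq' : 0 < 1 - q := by linarith
  -- The weights correspond to independent inclusion with probability `1 - p` in `U` and `q`
  -- outside. For `a = 0`, to first order, the mean size is `b` and the mean number of elements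
  -- outside `U` is `α k`.
  set l := q * p / ((1 - q) * (1 - p)) with hl
  set μ := (1 - p) / p with hμ
  have hl0 : 0 < l := by positivity
  have hμ0 : 0 < μ := by positivity
  -- Equivalent to `p + q ≤ 1`, which is `hcond`.
  have hl1 : l ≤ 1 := by
    rw [hl, div_le_one (by positivity)]
    nlinarith
  have h1μ : 1 + μ = 1 / p := by
    rw [hμ]
    field_simp
    ring
  have h1lμ : 1 + l * μ = 1 / (1 - q) := by
    rw [hμ, hl]
    field_simp
    ring
  refine ⟨fun n => (1 + μ) ^ b n * (1 + l * μ) ^ j n / (μ ^ b n * l ^ (α * k n)),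
    fun n => by positivity, fun n ι _ _ U a hι hU => ?_, ?_⟩
  · rw [le_div_iff₀ (by positivity)]
    have h := card_filter_mul_le U hU (α * k n) hl0 hl1 hμ0
    rwa [hι, Nat.add_sub_cancel_left] at h
  · have hlog : ∀ n : ℕ, Real.log ((1 + μ) ^ b n * (1 + l * μ) ^ j n / (μ ^ b n * l ^ (α * k n))) / n
        = (b n / n : ℝ) * (Real.log (1 + μ) - Real.log μ) + (j n / n : ℝ) * Real.log (1 + l * μ)
          - α * (k n / n : ℝ) * Real.log l := by
      intro n
      rw [Real.log_div (by positivity) (by positivity), Real.log_mul (by positivity) (by positivity),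
        Real.log_mul (by positivity) (by positivity), Real.log_pow, Real.log_pow, Real.log_pow,
        Real.log_rpow hl0]
      ring
    simp only [hlog]
    have hlim := ((hb.mul_const (Real.log (1 + μ) - Real.log μ)).add
      (hj.mul_const (Real.log (1 + l * μ)))).sub ((hk.const_mul α).mul_const (Real.log l))
    convert hlim using 2
    rw [h1μ, h1lμ, hμ, hl, Real.log_div one_ne_zero hp0.ne', Real.log_div one_ne_zero hq'.ne',
      Real.log_div hp'.ne' hp0.ne',
      Real.log_div (mul_pos hq0 hp0).ne' (mul_pos hq' hp').ne',
      Real.log_mul hq0.ne' hp0.ne', Real.log_mul hq'.ne' hp'.ne', Real.log_one,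
      Real.binEntropy, Real.binEntropy, Real.log_inv, Real.log_inv, Real.log_inv, Real.log_inv]
    have hpα : β * Ω * p = α * Ω := by
      rw [hp]
      field_simp
    have hqα : (1 - Ω) * q = α * Ω := by
      rw [hq]
      field_simp
    linear_combination (Real.log (1 - p) - Real.log p) * hpα
      + (Real.log (1 - q) - Real.log q) * hqα

/-- The right side is the exponent of all placements of the unrevealed entries minus that of the
placements close to one estimate, hence the exponent of `K`. -/
theorem mul_encodingRate_eq {Ω α β : ℝ} (hΩ0 : 0 < Ω) (hΩ1 : Ω < 1) (hβ0 : 0 < β)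
    (h : α / β < 1 - β * Ω / (1 - (1 - β) * Ω)) :
    (1 - (1 - β) * Ω) * encodingRate (β * Ω / (1 - (1 - β) * Ω)) (α / β)
      = ((β * Ω + (1 - Ω)) * Real.log (β * Ω + (1 - Ω)) - β * Ω * Real.log (β * Ω)
          - (1 - Ω) * Real.log (1 - Ω))
        - (β * Ω * Real.binEntropy (α / β) + (1 - Ω) * Real.binEntropy (α * Ω / (1 - Ω))) := by
  have hΩ' : 0 < 1 - Ω := by linarith
  have hc : 1 - (1 - β) * Ω = β * Ω + (1 - Ω) := by ring
  have hβΩ : 0 < β * Ω := by positivity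
  rw [hc] at h ⊢
  set c := β * Ω + (1 - Ω) with hcdef
  have hc0 : 0 < c := by positivity
  have h1 : 1 - β * Ω / c = (1 - Ω) / c := by
    field_simp
    ring
  have h2 : β * Ω / c * (α / β) / ((1 - Ω) / c) = α * Ω / (1 - Ω) := by
    field_simp
  rw [encodingRate, if_pos h, h1, h2]
  have h3 : c * Real.binEntropy (β * Ω / c)
      = c * Real.log c - β * Ω * Real.log (β * Ω) - (1 - Ω) * Real.log (1 - Ω) := by
    rw [Real.binEntropy, h1, Real.log_inv, Real.log_inv, Real.log_div hβΩ.ne' hc0.ne',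
      Real.log_div hΩ'.ne' hc0.ne']
    field_simp
    rw [hcdef]
    ring
  have h4 : c * (β * Ω / c * Real.binEntropy (α / β)) = β * Ω * Real.binEntropy (α / β) := by
    field_simp
  have h5 : c * ((1 - Ω) / c * Real.binEntropy (α * Ω / (1 - Ω)))
      = (1 - Ω) * Real.binEntropy (α * Ω / (1 - Ω)) := by
    field_simp
  rw [mul_sub, mul_sub, h3, h4, h5]
  ring

theorem sourceVariance_eq (Ω : ℝ) (G : Measure ℝ) [IsProbabilityMeasure G] (hG : MemLp id 2 G) :
    sourceVariance Ω G = Ω * (∫ x, x ^ 2 ∂G) - (Ω * ∫ x, x ∂G) ^ 2 := by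
  have h : variance id G = ∫ x, x ^ 2 ∂G - (∫ x, x ∂G) ^ 2 := variance_eq_sub hG
  rw [sourceVariance, h]
  ring

theorem tendsto_nat_floor_mul_floor {Ω β : ℝ} (hΩ : 0 < Ω) (hβ : 0 < β) :
    Tendsto (fun n : ℕ => ((⌊β * (⌊Ω * (n : ℝ)⌋₊ : ℕ)⌋₊ : ℕ) : ℝ) / n) atTop (𝓝 (β * Ω)) := by
  have h1 : Tendsto (fun n : ℕ => ((⌊Ω * (n : ℝ)⌋₊ : ℕ) : ℝ) / n) atTop (𝓝 Ω) :=
    (tendsto_nat_floor_mul_div_atTop hΩ.le).comp tendsto_natCast_atTop_atTop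
  have hk : Tendsto (fun n : ℕ => ((⌊Ω * (n : ℝ)⌋₊ : ℕ) : ℝ)) atTop atTop :=
    tendsto_natCast_atTop_atTop.comp
      (tendsto_nat_floor_atTop.comp (tendsto_natCast_atTop_atTop.const_mul_atTop hΩ))
  have h2 := ((tendsto_nat_floor_mul_div_atTop hβ.le).comp hk).mul h1
  refine h2.congr' ?_
  filter_upwards [hk.eventually_gt_atTop 0] with n hn
  simp only [Function.comp_apply]
  field_simp

/-- Along an achieving sequence of estimators the error probability vanishes uniformly over the
permutations of a sequence of vectors. -/
theorem exists_uniform_error {Ω α : ℝ} {F : Measure ℝ} {M : ℕ → ℕ}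
    (P : (n : ℕ) → SamplingMatrix (M n) n) (est : (n : ℕ) → Estimator (M n) n)
    (h : ∀ x ∈ source Ω F, Tendsto (fun n => errorProb (P n) (est n) α (x n)) atTop (𝓝 0))
    {x : (n : ℕ) → Fin n → ℝ}
    (hx : ∀ σ : (n : ℕ) → Equiv.Perm (Fin n), (fun n => x n ∘ σ n) ∈ source Ω F) :
    ∃ ε : ℕ → ℝ, (∀ n, 0 ≤ ε n ∧ ε n ≤ 1) ∧ Tendsto ε atTop (𝓝 0) ∧
      ∀ n (σ : Equiv.Perm (Fin n)),
        errorProb (P n) (est n) α (x n ∘ σ) ≤ ENNReal.ofReal (ε n) := by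
  have hmax : ∀ n, ∃ σ₀ : Equiv.Perm (Fin n), ∀ σ : Equiv.Perm (Fin n),
      errorProb (P n) (est n) α (x n ∘ σ) ≤ errorProb (P n) (est n) α (x n ∘ σ₀) := fun n =>
    Finite.exists_max _
  -- The sequence rearranged by the worst permutations still belongs to the source, so convergence
  -- along single sequences yields uniformity.
  choose σ₀ hσ₀ using hmax
  have hle : ∀ n, errorProb (P n) (est n) α (x n ∘ σ₀ n) ≤ 1 := fun n => by
    have := (P n).isProbabilityMeasure
    exact prob_le_one
  have hfin : ∀ n, errorProb (P n) (est n) α (x n ∘ σ₀ n) ≠ ⊤ := fun n =>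
    ne_top_of_le_ne_top ENNReal.one_ne_top (hle n)
  refine ⟨fun n => (errorProb (P n) (est n) α (x n ∘ σ₀ n)).toReal, fun n => ⟨ENNReal.toReal_nonneg,
    ENNReal.toReal_le_of_le_ofReal zero_le_one (by simpa using hle n)⟩, ?_, fun n σ => ?_⟩
  · have := (ENNReal.tendsto_toReal ENNReal.zero_ne_top).comp (h _ (hx σ₀))
    rwa [ENNReal.toReal_zero] at this
  · rw [ENNReal.ofReal_toReal (hfin n)]
    exact hσ₀ n σ

/-- The asymptotic converse for a rate `ρ` at which recovery is possible. -/
theorem mul_encodingRate_le {Ω : ℝ} (hΩ0 : 0 < Ω) (hΩ1 : Ω ≤ 1 / 2) (F : Measure ℝ)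
    [IsProbabilityMeasure F] (hF : MemLp id 2 F) (hF0 : F {0} = 0) {α β : ℝ} (hα : 0 ≤ α)
    (hβ0 : 0 < β) (hβ1 : β ≤ 1) {ρ : ℝ≥0} (hρ : Achievable (source Ω F) ρ α)
    (hpos : 0 < (1 - (1 - β) * Ω) * encodingRate (β * Ω / (1 - (1 - β) * Ω)) (α / β)) :
    (1 - (1 - β) * Ω) * encodingRate (β * Ω / (1 - (1 - β) * Ω)) (α / β)
      ≤ ρ / 2 * Real.log (1 + sourceVariance (β * Ω) (truncated F β)) := by
  have hΩlt : Ω < 1 := by linarith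
  have hΩ' : 0 < 1 - Ω := by linarith
  have hβΩ : 0 < β * Ω := by positivity
  have hcpos : 0 < 1 - (1 - β) * Ω := by nlinarith
  have hcond : α / β < 1 - β * Ω / (1 - (1 - β) * Ω) := by
    by_contra hcon
    rw [encodingRate, if_neg hcon, mul_zero] at hpos
    exact lt_irrefl _ hpos
  have hαβ : α < β := by
    rw [← div_lt_one hβ0]
    have : 0 < β * Ω / (1 - (1 - β) * Ω) := by positivity
    linarith
  -- `hcond` rearranges to `α / β + α * Ω / (1 - Ω) < 1`.
  have hcond' : α * Ω / (1 - Ω) ≤ 1 - α / β := by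
    have h1 : 1 - β * Ω / (1 - (1 - β) * Ω) = (1 - Ω) / (1 - (1 - β) * Ω) := by
      rw [one_sub_div hcpos.ne']
      congr 1
      ring
    rw [h1, div_lt_div_iff₀ hβ0 hcpos] at hcond
    rw [div_le_iff₀ hΩ', one_sub_div hβ0.ne', div_mul_eq_mul_div, le_div_iff₀ hβ0]
    nlinarith
  rw [mul_encodingRate_eq hΩ0 hΩlt hβ0 hcond] at hpos ⊢
  obtain ⟨⟨hGp, -, hGm⟩, -⟩ := exists_truncated_mixture F hF hF0 hβ0 hβ1
  rw [sourceVariance_eq _ _ hGm]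
  set m1 := ∫ x, x ∂truncated F β
  set m2 := ∫ x, x ^ 2 ∂truncated F β
  set k : ℕ → ℕ := fun n => ⌊Ω * (n : ℝ)⌋₊ with hk
  set b : ℕ → ℕ := fun n => ⌊β * (k n : ℝ)⌋₊ with hb
  have hkn : ∀ n, k n ≤ n := fun n =>
    Nat.floor_le_of_le (mul_le_of_le_one_left (Nat.cast_nonneg n) hΩlt.le)
  have hbk : ∀ n, b n ≤ k n := fun n =>
    Nat.floor_le_of_le (mul_le_of_le_one_left (Nat.cast_nonneg _) hβ1)
  have hklim : Tendsto (fun n : ℕ => (k n : ℝ) / n) atTop (𝓝 Ω) :=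
    (tendsto_nat_floor_mul_div_atTop hΩ0.le).comp tendsto_natCast_atTop_atTop
  have hblim : Tendsto (fun n : ℕ => (b n : ℝ) / n) atTop (𝓝 (β * Ω)) :=
    tendsto_nat_floor_mul_floor hΩ0 hβ0
  have hjlim : Tendsto (fun n : ℕ => ((n - k n : ℕ) : ℝ) / n) atTop (𝓝 (1 - Ω)) := by
    refine (hklim.const_sub 1).congr' ?_
    filter_upwards [eventually_gt_atTop 0] with n hn
    have : (n : ℝ) ≠ 0 := by exact_mod_cast hn.ne'
    rw [Nat.cast_sub (hkn n)]
    field_simp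
  have hinv : Tendsto (fun n : ℕ => 1 / (n : ℝ)) atTop (𝓝 0) := tendsto_one_div_atTop_nhds_zero_nat
  choose x T hT hcard hTcard hmean hsq happrox using fun n =>
    exists_source_vector F hF hF0 hβ0 hβ1 (hkn n)
  obtain ⟨P, est, hach⟩ := hρ
  obtain ⟨ε, hε01, hεlim, hεerr⟩ := exists_uniform_error P est hach
    (comp_mem_source hΩ0 F hcard happrox)
  obtain ⟨L, hL0, hL, hLlim⟩ :=
    exists_pattern_count_bound hΩ0 hΩlt hα hβ0 hαβ hcond' hklim hblim hjlim
  obtain ⟨u, hu, hulim⟩ := exists_tendsto_le_log_choose hblim hjlim fun n => by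
    have := hkn n
    have := hbk n
    lia
  set s : ℕ → ℝ := fun n => ∑ i ∈ (T n)ᶜ, x n i with hs
  -- The `max` supplies `0 ≤ w n` for every `n`; it disappears in the limit, where the variance is
  -- nonnegative.
  set w : ℕ → ℝ := fun n =>
    max 0 ((b n * m2 + 2 - s n ^ 2 / n) / ((n : ℝ) - 1)) with hw
  have hslim : Tendsto (fun n : ℕ => s n / n) atTop (𝓝 (β * Ω * m1)) := by
    have h1 : Tendsto (fun n : ℕ => (s n - b n * m1) / n) atTop (𝓝 0) := by
      refine squeeze_zero_norm (a := fun n : ℕ => 2 * (1 / (n : ℝ))) (fun n => ?_)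
        (by simpa using hinv.const_mul 2)
      rw [norm_div, Real.norm_eq_abs, Real.norm_natCast, mul_one_div]
      exact div_le_div_of_nonneg_right (hmean n) (Nat.cast_nonneg n)
    have h2 := h1.add (hblim.mul_const m1)
    rw [zero_add] at h2
    refine h2.congr fun n => ?_
    ring
  have hwlim : Tendsto w atTop (𝓝 (max 0 (β * Ω * m2 - (β * Ω * m1) ^ 2))) := by
    refine tendsto_const_nhds.max ?_
    have h1 := ((hblim.mul_const m2).add (hinv.const_mul 2)).sub (hslim.pow 2)
    have h2 := h1.div (hinv.const_sub 1) (by norm_num)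
    rw [mul_zero, add_zero, sub_zero, div_one] at h2
    refine h2.congr' ?_
    filter_upwards [eventually_gt_atTop 1] with n hn
    have hn0 : (n : ℝ) ≠ 0 := by
      have : n ≠ 0 := by lia
      exact_mod_cast this
    have hn1 : (n : ℝ) - 1 ≠ 0 := by
      have : (1 : ℝ) < n := by exact_mod_cast hn
      linarith
    simp only [Pi.div_apply]
    field_simp
  have hV : 0 ≤ β * Ω * m2 - (β * Ω * m1) ^ 2 := by
    have h := sourceVariance_eq (β * Ω) _ hGm
    rw [← h, sourceVariance]
    have h1 := variance_nonneg id (truncated F β)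
    have h2 : 0 ≤ 1 - β * Ω := by nlinarith
    positivity
  rw [max_eq_right hV] at hwlim
  have hrate : ∀ᶠ n : ℕ in atTop, (u n - Real.log (L n) / n) * (1 - ε n)
      ≤ 1 / n + (ρ + 1 / n) / 2 * Real.log (1 + w n) := by
    -- A positive limiting exponent forces `K = C / L n ≥ 1` eventually, as the nonasymptotic
    -- converse requires.
    have hev := (hulim.sub hLlim).eventually (lt_mem_nhds hpos)
    have hkev : ∀ᶠ n in atTop, 0 < (k n : ℝ) / n := hklim.eventually (lt_mem_nhds hΩ0)
    filter_upwards [hev, hkev, hu, eventually_ge_atTop 2] with n h1 h2 h3 hn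
    have hn0 : (0 : ℝ) < n := by
      have : 0 < n := by lia
      exact_mod_cast this
    have hkpos : 0 < k n := by
      have := (div_pos_iff_of_pos_right hn0).1 h2
      exact_mod_cast this
    set C : ℝ := (((b n + (n - k n)).choose (b n) : ℕ) : ℝ) with hC
    have hC0 : 0 < C := by
      rw [hC]
      exact_mod_cast Nat.choose_pos (Nat.le_add_right _ _)
    have hlogK : u n - Real.log (L n) / n ≤ Real.log (C / L n) / n := by
      rw [Real.log_div hC0.ne' (hL0 n).ne', sub_div]
      linarith
    have hK1 : 1 ≤ C / L n := by
      have h4 : 0 < Real.log (C / L n) := (div_pos_iff_of_pos_right hn0).1 (h1.trans_le hlogK)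
      by_contra! h5
      exact absurd (Real.log_nonpos (div_pos hC0 (hL0 n)).le h5.le) (not_le.2 h4)
    have hTn : Fintype.card {i // i ∉ T n} = b n + (n - k n) := by
      rw [Fintype.card_subtype_compl, Fintype.card_fin, Fintype.card_coe]
      have := hTcard n
      have := hkn n
      simp only [hb]
      lia
    have hn1 : (0 : ℝ) < (n : ℝ) - 1 := by
      have : (2 : ℝ) ≤ n := by exact_mod_cast hn
      linarith
    have hmain := log_mul_one_sub_le hn (P n) (est n) (b := b n) (hT n)
      (by rw [hcard]; exact hTcard n) (by rw [hcard]; exact hkpos) (α := α) hK1 (hε01 n).1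
      (hε01 n).2 (fun U a hU => by
        rw [hTn, hcard]
        rw [div_mul_eq_mul_div, div_le_iff₀ (hL0 n)]
        exact mul_le_mul_of_nonneg_left (hL n _ U a hTn hU) hC0.le) (hεerr n)
      (w := w n) (le_max_left _ _) (by
        refine le_trans ?_ (mul_le_mul_of_nonneg_right (le_max_right _ _) hn1.le)
        rw [div_mul_cancel₀ _ hn1.ne']
        exact sub_le_sub_right (hsq n) _)
    have hM : ((⌈ρ * (n : ℝ≥0)⌉₊ : ℕ) : ℝ) ≤ ρ * n + 1 := by
      have h := (Nat.ceil_lt_add_one (zero_le : 0 ≤ ρ * (n : ℝ≥0))).le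
      exact_mod_cast NNReal.coe_le_coe.2 h
    have hlogw : 0 ≤ Real.log (1 + w n) :=
      Real.log_nonneg (by linarith [le_max_left 0 ((b n * m2 + 2 - s n ^ 2 / n) / ((n : ℝ) - 1))])
    have hstep : Real.log (C / L n) * (1 - ε n) ≤ 1 + (ρ * n + 1) / 2 * Real.log (1 + w n) := by
      refine hmain.trans ?_
      gcongr
    calc (u n - Real.log (L n) / n) * (1 - ε n) ≤ Real.log (C / L n) / n * (1 - ε n) :=
          mul_le_mul_of_nonneg_right hlogK (by linarith [(hε01 n).2])
      _ = Real.log (C / L n) * (1 - ε n) / n := by ring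
      _ ≤ (1 + (ρ * n + 1) / 2 * Real.log (1 + w n)) / n := by gcongr
      _ = 1 / n + (ρ + 1 / n) / 2 * Real.log (1 + w n) := by
          field_simp
  have hl := (hulim.sub hLlim).mul (hεlim.const_sub 1)
  have hr := hinv.add (((hinv.const_add (ρ : ℝ)).div_const 2).mul
    ((hwlim.const_add 1).log (by linarith)))
  rw [sub_zero, mul_one] at hl
  rw [add_zero, zero_add] at hr
  exact le_of_tendsto_of_tendsto hl hr hrate

end SparsityRecovery

end

theorem theorem3 (Ω : ℝ) (hΩ_pos : 0 < Ω) (hΩ_le : Ω ≤ 1 / 2)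
    (F : Measure ℝ) [IsProbabilityMeasure F] (hF_sq : MemLp id 2 F) (hF_zero : F {0} = 0)
    (α : ℝ) (hα_nonneg : 0 ≤ α) (hα_le : α ≤ 1) :
    (⨆ β ∈ {β : ℝ | 0 < β ∧ α ≤ β ∧ β ≤ 1},
      ENNReal.ofReal
        (2 * (1 - (1 - β) * Ω)
            * SparsityRecovery.encodingRate (β * Ω / (1 - (1 - β) * Ω)) (α / β)
          / Real.log (1 + SparsityRecovery.sourceVariance (β * Ω)
              (SparsityRecovery.truncated F β))))
      ≤ SparsityRecovery.rateDistortion (SparsityRecovery.source Ω F) α := by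
  refine iSup₂_le fun β hβ => le_iInf₂ fun ρ hρ => ?_
  obtain ⟨hβ0, -, hβ1⟩ := hβ
  rw [← ENNReal.ofReal_coe_nnreal]
  refine ENNReal.ofReal_le_ofReal ?_
  obtain ⟨⟨hGp, -, hGm⟩, -⟩ :=
    SparsityRecovery.exists_truncated_mixture F hF_sq hF_zero hβ0 hβ1
  have hV : 0 ≤ SparsityRecovery.sourceVariance (β * Ω) (SparsityRecovery.truncated F β) := by
    have h1 := variance_nonneg id (SparsityRecovery.truncated F β)
    have h2 : 0 ≤ 1 - β * Ω := by nlinarith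
    rw [SparsityRecovery.sourceVariance]
    positivity
  have hlog := Real.log_nonneg (le_add_of_nonneg_right hV : (1 : ℝ) ≤ 1 + _)
  rw [mul_assoc 2]
  -- A nonpositive rate makes the bound trivial; this covers the zero branch of `encodingRate`, in
  -- particular `β = α`.
  rcases le_or_gt ((1 - (1 - β) * Ω)
    * SparsityRecovery.encodingRate (β * Ω / (1 - (1 - β) * Ω)) (α / β)) 0 with h | h
  · exact (div_nonpos_of_nonpos_of_nonneg (by linarith) hlog).trans ρ.2
  · have hmain := SparsityRecovery.mul_encodingRate_le hΩ_pos hΩ_le F hF_sq hF_zero hα_nonneg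
      hβ0 hβ1 hρ h
    refine div_le_of_le_mul₀ hlog ρ.2 ?_
    linarith
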